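/- **Proposition 1.2 (Existence of minimizers).** Let $d\ge 1$, $\ell>0$, let $\mathbb T_\ell=\mathbb R^d/(\ell\mathbb Z)^d$ be the flat torus, and let $\omega_{d-1}$ be the volume of the unit ball of $\mathbb R^{d-1}$ ($\omega_0=1$). Let $K_\epsilon$ ($\epsilon\ge 0$) be nonnegative measurable radial kernels on $\mathbb R^d$, $K_\epsilon(z)=K_\epsilon(|z|)$, with $K_\epsilon\in L^1(B_1)$ for $\epsilon>0$, such that $K_\epsilon(r)\to K_0(r)$ as $\epsilon\searrow0$ for every $r>0$, $K_\epsilon(r)$ is nonincreasing in $\epsilon\ge 0$ for every $0<r<1$, and $$\int_0^\infty K_0(r)r^{d-1}\,dr=\infty,\qquad \int_\delta^\infty K_\epsilon(r)\min\{r^{d-2},r^{d-1}\}\,dr<\infty\quad\text{for all }\delta>0,\ \epsilon\ge 0 .$$ (If $K_\epsilon\nearrow K_0$ on all of $(0,\infty)$, the last condition for $K_0$ implies the one for every $K_\epsilon$.) Put $$M_\epsilon=\omega_{d-1}\int_0^1K_\epsilon(t)t^{d-1}\,dt\in[0,\infty].$$ For $u\in BV(\mathbb T_\ell;\{0,1\})$,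 identified with an $\ell$-periodic function on $\mathbb R^d$, let $$\mathcal E_\epsilon(u)=M_\epsilon\fint_{\mathbb T_\ell}|\nabla u|\,dx-\int_{\mathbb R^d}K_\epsilon(z)\fint_{\mathbb T_\ell}\frac{|u(x+z)-u(x)|}{2|z|}\,dx\,dz\qquad(\epsilon>0),$$ $$\mathcal E_0(u)=\frac12\int_{\mathbb R^d}\fint_{\mathbb T_\ell}K_0(|z|)\Big(\Big|\frac{z}{|z|}\cdot\nabla u(x)\Big|\chi_{B_1}(z)-\frac{|u(x+z)-u(x)|}{|z|}\Big)\,dx\,dz\ \in(-\infty,+\infty],$$ where the inner integrals of $|\nabla u|$ and $|\omega\cdot\nabla u|$ are total variations of the measures $\nabla u$ and $\omega\cdot\nabla u$ on $\mathbb T_\ell$, and $\fint_{\mathbb T_\ell}=\ell^{-d}\int_{\mathbb T_\ell}$. Then for every $\lambda\in[0,1]$ and every $\epsilon\ge0$ with $M_\epsilon>0$, the functional $\mathcal E_\epsilon$ has a minimizer in the class of all $u\in BV(\mathbb T_\ell;\{0,1\})$ with $\fint_{\mathbb T_\ell}u\,dx=\lambda$. (If $K_0(r)r^{d-1}$ is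 not integrable at $r=0$, then $M_\epsilon>0$ for $\epsilon=0$ and for all sufficiently small $\epsilon>0$.) -/

import Mathlib

open MeasureTheory Set Filter Topology
open scoped NNReal ENNReal

namespace NonlocalPerimeter

noncomputable section

/-- Functions on the flat torus `ℝ^d / (ℓ ℤ)^d` are identified with functions on `ℝ^d` that are
`ℓ`-periodic in every coordinate. -/
def IsPeriodic {d : ℕ} (ℓ : ℝ) {F : Type*} (f : EuclideanSpace ℝ (Fin d) → F) : Prop :=
  ∀ (i : Fin d) (x : EuclideanSpace ℝ (Fin d)), f (x + EuclideanSpace.single i ℓ) = f x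

/-- The periodicity cell `[0, ℓ)^d`. Integrals over the torus are integrals over this cell. -/
def cell (d : ℕ) (ℓ : ℝ) : Set (EuclideanSpace ℝ (Fin d)) :=
  {x | ∀ i, x i ∈ Ico 0 ℓ}

/-- The divergence of a vector field on `ℝ^d`. -/
def divergence {d : ℕ} (φ : EuclideanSpace ℝ (Fin d) → EuclideanSpace ℝ (Fin d))
    (x : EuclideanSpace ℝ (Fin d)) : ℝ :=
  ∑ i, (fderiv ℝ φ x (EuclideanSpace.single i 1)) i

/-- The total variation `|∇u|(𝕋_ℓ)` of the distributional gradient of `u` on the torus. -/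
def totalVariation {d : ℕ} (ℓ : ℝ) (u : EuclideanSpace ℝ (Fin d) → ℝ) : ℝ≥0∞ :=
  ⨆ (φ : EuclideanSpace ℝ (Fin d) → EuclideanSpace ℝ (Fin d)) (_ : ContDiff ℝ 1 φ)
    (_ : IsPeriodic ℓ φ) (_ : ∀ x, ‖φ x‖ ≤ 1),
    ENNReal.ofReal (∫ x in cell d ℓ, u x * divergence φ x)

/-- The total variation `|ω · ∇u|(𝕋_ℓ)` of the scalar distribution `ω · ∇u` on the torus, that is,
`∫ |ω · σ| d|∇u|` when `∇u = σ |∇u|` is a measure. -/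
def directionalVariation {d : ℕ} (ℓ : ℝ) (ω : EuclideanSpace ℝ (Fin d))
    (u : EuclideanSpace ℝ (Fin d) → ℝ) : ℝ≥0∞ :=
  ⨆ (φ : EuclideanSpace ℝ (Fin d) → ℝ) (_ : ContDiff ℝ 1 φ)
    (_ : IsPeriodic ℓ φ) (_ : ∀ x, |φ x| ≤ 1),
    ENNReal.ofReal (∫ x in cell d ℓ, u x * fderiv ℝ φ x ω)

/-- The class `BV(𝕋_ℓ; {0,1})`. -/
def BVIndicator (d : ℕ) (ℓ : ℝ) : Set (EuclideanSpace ℝ (Fin d) → ℝ) :=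
  {u | Measurable u ∧ IsPeriodic ℓ u ∧ (∀ x, u x = 0 ∨ u x = 1) ∧ totalVariation ℓ u < ⊤}

/-- The elements `u` of `BV(𝕋_ℓ; {0,1})` whose mean over the torus is the prescribed volume
fraction. -/
def admissible (d : ℕ) (ℓ fraction : ℝ) : Set (EuclideanSpace ℝ (Fin d) → ℝ) :=
  {u | u ∈ BVIndicator d ℓ ∧ ⨍ x in cell d ℓ, u x = fraction}

/-- `M = ω_{d-1} ∫_0^1 κ(t) t^{d-1} dt` for a radial kernel `κ`, where `ω_{d-1}` is the volume of
the unit ball of `ℝ^{d-1}` (so that `ω_0 = 1`). -/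
def kernelMass (d : ℕ) (κ : ℝ → ℝ≥0) : ℝ≥0∞ :=
  volume (Metric.ball (0 : EuclideanSpace ℝ (Fin (d - 1))) 1) *
    ∫⁻ t in Ioo (0 : ℝ) 1, κ t * ENNReal.ofReal (t ^ (d - 1))

/-- The assumptions on a family `(K_ε)_{ε ≥ 0}` of radial kernels (profiles `K ε : r ↦ K_ε(r)`)
in dimension `d`. Monotonicity in `ε` is asked only on `0 < r < 1`, and in exchange each `K_ε`
satisfies the tail condition; if `K_ε ↗ K_0` on all of `(0, ∞)`, the tail condition for `K_0`
implies the one for every `K_ε`. -/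
structure IsKernelFamily (d : ℕ) (K : ℝ → ℝ → ℝ≥0) : Prop where
  measurable : ∀ ε, 0 ≤ ε → Measurable (K ε)
  /-- `K_ε` increases as `ε` decreases -/
  antitone : ∀ r ∈ Ioo (0 : ℝ) 1, AntitoneOn (fun ε => K ε r) (Ici 0)
  /-- `K_ε → K_0` pointwise as `ε ↘ 0` -/
  tendsto : ∀ r, 0 < r → Tendsto (fun ε => K ε r) (𝓝[>] 0) (𝓝 (K 0 r))
  /-- `K_ε ∈ L^1(B_1)` for `ε > 0`, written in polar coordinates -/
  integrable : ∀ ε, 0 < ε → ∫⁻ r in Ioo (0 : ℝ) 1, K ε r * ENNReal.ofReal (r ^ (d - 1)) < ⊤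
  /-- `∫_0^∞ K_0(r) r^{d-1} dr = ∞` -/
  singular : ∫⁻ r in Ioi (0 : ℝ), K 0 r * ENNReal.ofReal (r ^ (d - 1)) = ⊤
  /-- `∫_δ^∞ K_ε(r) min {r^{d-2}, r^{d-1}} dr < ∞` for all `δ > 0` -/
  tail : ∀ ε, 0 ≤ ε → ∀ δ : ℝ, 0 < δ →
    ∫⁻ r in Ioi δ, K ε r *
      ENNReal.ofReal (min (r ^ ((d : ℤ) - 2)) (r ^ ((d : ℤ) - 1))) < ⊤

/-- The extended-real integral `∫ f⁺ - ∫ f⁻` over `ℝ^d` (meaningful if one of the two is finite). -/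
def extIntegral {d : ℕ} (f : EuclideanSpace ℝ (Fin d) → ℝ) : EReal :=
  ((∫⁻ z, ENNReal.ofReal (f z) : ℝ≥0∞) : EReal) - ((∫⁻ z, ENNReal.ofReal (-f z) : ℝ≥0∞) : EReal)

/-- The energy with an integrable kernel `κ`:
`M ⨍ |∇u| dx - ∫ κ(|z|) ⨍ |u(x+z) - u(x)| / (2|z|) dx dz`. -/
def approxEnergy {d : ℕ} (ℓ : ℝ) (κ : ℝ → ℝ≥0) (u : EuclideanSpace ℝ (Fin d) → ℝ) : EReal :=
  ((kernelMass d κ * (totalVariation ℓ u / volume (cell d ℓ)) : ℝ≥0∞) : EReal) -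
    ((∫⁻ z : EuclideanSpace ℝ (Fin d), κ ‖z‖ *
      ((∫⁻ x in cell d ℓ, ENNReal.ofReal (|u (x + z) - u x| / (2 * ‖z‖))) / volume (cell d ℓ)) :
        ℝ≥0∞) : EReal)

/-- The limit energy
`(1/2) ∫ ⨍ κ(|z|) (|(z/|z|) · ∇u(x)| χ_{B_1}(z) - |u(x+z) - u(x)| / |z|) dx dz`. -/
def limitEnergy {d : ℕ} (ℓ : ℝ) (κ : ℝ → ℝ≥0) (u : EuclideanSpace ℝ (Fin d) → ℝ) : EReal :=
  extIntegral fun z : EuclideanSpace ℝ (Fin d) =>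
    (1 / 2) * ((κ ‖z‖ : ℝ) *
      ((Metric.ball (0 : EuclideanSpace ℝ (Fin d)) 1).indicator
          (fun z => (directionalVariation ℓ (‖z‖⁻¹ • z) u / volume (cell d ℓ)).toReal) z
        - (⨍ x in cell d ℓ, |u (x + z) - u x| / ‖z‖)))

/-- The energy `𝓔_ε` for `ε ≥ 0`. -/
def energy {d : ℕ} (ℓ : ℝ) (K : ℝ → ℝ → ℝ≥0) (ε : ℝ) (u : EuclideanSpace ℝ (Fin d) → ℝ) : EReal :=
  if ε = 0 then limitEnergy ℓ (K 0) u else approxEnergy ℓ (K ε) u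

end

end NonlocalPerimeter

/-! The proof is the direct method. The class is nonempty because a periodic slab has any prescribed
volume fraction and finite perimeter. What remains is compactness of sets of bounded perimeter, and
lower semicontinuity and coercivity of the energies; `exists_isMinOn_admissible` combines these.

Everything rests on one estimate, `lintegral_translate_sub_le`: translating `u` by `z` changes it in
`L^1` of the torus by at most the variation of `u` along `z`. For compactness, it makes `u`
uniformly close to its averages over small balls. Along a weakly convergent subsequence these
averages converge pointwise, so the functions themselves are Cauchy in `L^1`. For the energies, it
bounds the nonlocal term near `z = 0` by the perimeter; far from the origin that term is dominated
by `κ(|z|)/|z|`, which is integrable by the tail condition.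

For `ε > 0` the perimeter term is lower semicontinuous and the nonlocal term is continuous along
sequences of bounded perimeter. The factor `1/2` in the nonlocal term gives coercivity: close to the
origin it consumes at most half of the perimeter term, and the rest is bounded.

For `ε = 0` the two terms may both be infinite, so they are kept together. The same estimate says
that the integrand is nonnegative in the unit ball, where Fatou's lemma applies; outside, dominated
convergence does. For coercivity, the energy bounds the `κ`-weighted average of the directional
variations over an annulus away from the origin. Averaging over the reflections fixing each axis
turns this into a bound on the variation along that axis, hence on the perimeter. -/

namespace NonlocalPerimeter

/-! ### The periodicity cell as a fundamental domain of the period lattice. -/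

section Cell

open scoped Pointwise

variable {d : ℕ} {ℓ : ℝ} {F : Type*}

/-- The basis `ℓ e_i` of `ℝ^d`. -/
noncomputable def latticeBasis (d : ℕ) {ℓ : ℝ} (hℓ : 0 < ℓ) :
    Module.Basis (Fin d) ℝ (EuclideanSpace ℝ (Fin d)) :=
  (EuclideanSpace.basisFun (Fin d) ℝ).toBasis.isUnitSMul (w := fun _ => ℓ)
    fun _ => hℓ.ne'.isUnit

lemma latticeBasis_apply (hℓ : 0 < ℓ) (i : Fin d) :
    latticeBasis d hℓ i = EuclideanSpace.single i ℓ := by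
  ext j
  simp [latticeBasis, Module.Basis.isUnitSMul_apply, PiLp.single_apply]

lemma cell_eq_fundamentalDomain (hℓ : 0 < ℓ) :
    cell d ℓ = ZSpan.fundamentalDomain (latticeBasis d hℓ) := by
  ext x
  simp only [cell, mem_ofPred_eq, ZSpan.mem_fundamentalDomain, latticeBasis,
    Module.Basis.repr_isUnitSMul]
  refine forall_congr' fun i => ?_
  have : (hℓ.ne'.isUnit.unit⁻¹ : ℝˣ) • (EuclideanSpace.basisFun (Fin d) ℝ).toBasis.repr x i
      = x i / ℓ := by
    simp [Units.smul_def, div_eq_inv_mul]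
  rw [this, mem_Ico, mem_Ico, le_div_iff₀ hℓ, div_lt_iff₀ hℓ]
  simp

/-- The period lattice. -/
noncomputable abbrev lattice (d : ℕ) {ℓ : ℝ} (hℓ : 0 < ℓ) :
    AddSubgroup (EuclideanSpace ℝ (Fin d)) :=
  (Submodule.span ℤ (range (latticeBasis d hℓ))).toAddSubgroup

instance (hℓ : 0 < ℓ) : Countable (lattice d hℓ) :=
  inferInstanceAs (Countable (Submodule.span ℤ (range (latticeBasis d hℓ))))

lemma isAddFundamentalDomain_cell (hℓ : 0 < ℓ) :
    IsAddFundamentalDomain (lattice d hℓ) (cell d ℓ) volume := by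
  rw [cell_eq_fundamentalDomain hℓ]
  exact ZSpan.isAddFundamentalDomain' _ _

lemma measurableSet_cell : MeasurableSet (cell d ℓ) := by
  have : cell d ℓ = ⋂ i, (fun x : EuclideanSpace ℝ (Fin d) => x i) ⁻¹' Ico 0 ℓ := by
    ext x; simp [cell]
  rw [this]
  exact MeasurableSet.iInter fun i => measurableSet_Ico.preimage (by fun_prop)

lemma cell_eq_preimage :
    cell d ℓ = WithLp.ofLp ⁻¹' (univ.pi fun _ => Ico 0 ℓ) := by
  ext x; simp [cell]

lemma volume_cell : volume (cell d ℓ) = ENNReal.ofReal ℓ ^ d := by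
  rw [cell_eq_preimage, (PiLp.volume_preserving_ofLp (Fin d)).measure_preimage
    (MeasurableSet.univ_pi fun _ => measurableSet_Ico).nullMeasurableSet, Real.volume_pi_Ico]
  simp

lemma volume_cell_ne_top : volume (cell d ℓ) ≠ ⊤ := by
  rw [volume_cell]; exact ENNReal.pow_ne_top ENNReal.ofReal_ne_top

lemma volume_cell_ne_zero (hℓ : 0 < ℓ) : volume (cell d ℓ) ≠ 0 := by
  rw [volume_cell]; exact pow_ne_zero _ (by simpa using hℓ)

instance : IsFiniteMeasure (volume.restrict (cell d ℓ)) :=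
  isFiniteMeasure_restrict.2 volume_cell_ne_top

lemma norm_le_of_mem_cell {x : EuclideanSpace ℝ (Fin d)} (hx : x ∈ cell d ℓ) :
    ‖x‖ ≤ √(d * ℓ ^ 2) := by
  rw [EuclideanSpace.norm_eq]
  refine Real.sqrt_le_sqrt ?_
  calc ∑ i, ‖x i‖ ^ 2 ≤ ∑ _i : Fin d, ℓ ^ 2 := by
        refine Finset.sum_le_sum fun i _ => ?_
        rw [Real.norm_of_nonneg (hx i).1]
        exact pow_le_pow_left₀ (hx i).1 (hx i).2.le 2
    _ = d * ℓ ^ 2 := by simp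

lemma isBounded_cell : Bornology.IsBounded (cell d ℓ) :=
  isBounded_iff_forall_norm_le.2 ⟨_, fun _ hx => norm_le_of_mem_cell hx⟩

lemma integrableOn_cell {F : Type*} [NormedAddCommGroup F]
    {f : EuclideanSpace ℝ (Fin d) → F} (hf : Continuous f) : IntegrableOn f (cell d ℓ) :=
  (hf.continuousOn.integrableOn_compact isBounded_cell.isCompact_closure).mono_set subset_closure

lemma IsPeriodic.add_mem_lattice (hℓ : 0 < ℓ) {f : EuclideanSpace ℝ (Fin d) → F}
    (hf : IsPeriodic ℓ f) (v : EuclideanSpace ℝ (Fin d)) (hv : v ∈ lattice d hℓ)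
    (x : EuclideanSpace ℝ (Fin d)) : f (v + x) = f x := by
  rw [Submodule.mem_toAddSubgroup] at hv
  induction hv using Submodule.span_induction generalizing x with
  | mem v hv =>
    obtain ⟨i, rfl⟩ := hv
    rw [latticeBasis_apply, add_comm, hf i x]
  | zero => simp
  | add v w _ _ hv hw => rw [add_assoc, hv, hw]
  | smul n v _ hv =>
    induction n generalizing x with
    | zero => simp
    | succ n ih => rw [add_smul, one_smul, add_assoc, ih, hv]
    | pred n ih =>
      rw [← hv, ← add_assoc, sub_smul, one_smul, add_sub_cancel, ih]

lemma IsPeriodic.comp {G : Type*} {f : EuclideanSpace ℝ (Fin d) → F} (hf : IsPeriodic ℓ f)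
    (g : F → G) : IsPeriodic ℓ fun x => g (f x) := fun i x => congrArg g (hf i x)

lemma IsPeriodic.comp₂ {G H : Type*} {f : EuclideanSpace ℝ (Fin d) → F} (hf : IsPeriodic ℓ f)
    {g : EuclideanSpace ℝ (Fin d) → G} (hg : IsPeriodic ℓ g)
    (h : F → G → H) : IsPeriodic ℓ fun x => h (f x) (g x) := fun i x => by
  simp only [hf i x, hg i x]

lemma IsPeriodic.comp_add_right {f : EuclideanSpace ℝ (Fin d) → F} (hf : IsPeriodic ℓ f)
    (z : EuclideanSpace ℝ (Fin d)) : IsPeriodic ℓ fun x => f (x + z) := fun i x => by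
  simp only [add_right_comm, hf i]

lemma IsPeriodic.comp_sub_right {f : EuclideanSpace ℝ (Fin d) → F} (hf : IsPeriodic ℓ f)
    (z : EuclideanSpace ℝ (Fin d)) : IsPeriodic ℓ fun x => f (x - z) := by
  simpa [sub_eq_add_neg] using hf.comp_add_right (-z)

lemma isAddFundamentalDomain_vadd_cell (hℓ : 0 < ℓ) (z : EuclideanSpace ℝ (Fin d)) :
    IsAddFundamentalDomain (lattice d hℓ) (z +ᵥ cell d ℓ) volume :=
  (isAddFundamentalDomain_cell hℓ).vadd_of_comm z

/-- A translate of the cell is again a fundamental domain, and a lattice-invariant function has the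
same integral over any two of these. -/
lemma setIntegral_cell_add [NormedAddCommGroup F] [NormedSpace ℝ F] (hℓ : 0 < ℓ)
    {f : EuclideanSpace ℝ (Fin d) → F}
    (hf : IsPeriodic ℓ f) (z : EuclideanSpace ℝ (Fin d)) :
    ∫ x in cell d ℓ, f (x + z) = ∫ x in cell d ℓ, f x := by
  rw [(isAddFundamentalDomain_cell hℓ).setIntegral_eq (isAddFundamentalDomain_vadd_cell hℓ z)
    (f := f) fun g x => hf.add_mem_lattice hℓ g g.2 x]
  have := (measurePreserving_add_left volume z).setIntegral_image_emb
    (measurableEmbedding_addLeft z) f (cell d ℓ)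
  simp only [add_comm _ z]
  rw [← this]
  rfl

/-- A periodic property that holds a.e. in the cell holds a.e. -/
lemma ae_of_ae_cell (hℓ : 0 < ℓ) {p : EuclideanSpace ℝ (Fin d) → Prop}
    (hp : IsPeriodic ℓ p) (h : ∀ᵐ x ∂volume.restrict (cell d ℓ), p x) : ∀ᵐ x, p x := by
  -- The exceptional set is lattice-invariant and meets a fundamental domain in a null set.
  refine (isAddFundamentalDomain_cell hℓ).measure_zero_of_invariant {x | ¬ p x} (fun g => ?_) ?_
  · ext x
    rw [mem_vadd_set_iff_neg_vadd_mem]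
    have := hp.add_mem_lattice hℓ (-g : lattice d hℓ) (-g).2 x
    simp only [mem_ofPred_eq, AddSubgroup.vadd_def]
    exact not_congr (iff_of_eq this)
  · rw [ae_iff, Measure.restrict_apply' measurableSet_cell] at h
    exact h

end Cell

/-! ### Total and directional variation: comparison and lower semicontinuity. -/

section Variation

variable {d : ℕ} {ℓ : ℝ} {u v : EuclideanSpace ℝ (Fin d) → ℝ}

lemma integrableOn_cell_mul (hu : Measurable u) (hb : ∀ x, |u x| ≤ 1)
    {g : EuclideanSpace ℝ (Fin d) → ℝ} (hg : IntegrableOn g (cell d ℓ)) :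
    IntegrableOn (fun x => u x * g x) (cell d ℓ) :=
  hg.bdd_mul hu.aestronglyMeasurable (Eventually.of_forall hb)

lemma continuous_fderiv_apply_const {φ : EuclideanSpace ℝ (Fin d) → ℝ} (hφ : ContDiff ℝ 1 φ)
    (w : EuclideanSpace ℝ (Fin d)) : Continuous fun x => fderiv ℝ φ x w :=
  (hφ.continuous_fderiv one_ne_zero).clm_apply continuous_const

lemma continuous_divergence {φ : EuclideanSpace ℝ (Fin d) → EuclideanSpace ℝ (Fin d)}
    (hφ : ContDiff ℝ 1 φ) : Continuous (divergence φ) := by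
  unfold divergence
  refine continuous_finsetSum _ fun i _ => ?_
  have : Continuous fun x => fderiv ℝ φ x (EuclideanSpace.single i 1) :=
    (hφ.continuous_fderiv one_ne_zero).clm_apply continuous_const
  fun_prop

lemma le_directionalVariation (w : EuclideanSpace ℝ (Fin d))
    {φ : EuclideanSpace ℝ (Fin d) → ℝ} (hφ : ContDiff ℝ 1 φ) (hp : IsPeriodic ℓ φ)
    (hb : ∀ x, |φ x| ≤ 1) :
    ENNReal.ofReal (∫ x in cell d ℓ, u x * fderiv ℝ φ x w) ≤ directionalVariation ℓ w u :=
  le_iSup_of_le φ <| le_iSup_of_le hφ <| le_iSup_of_le hp <| le_iSup_of_le hb le_rfl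

lemma le_totalVariation {φ : EuclideanSpace ℝ (Fin d) → EuclideanSpace ℝ (Fin d)}
    (hφ : ContDiff ℝ 1 φ) (hp : IsPeriodic ℓ φ) (hb : ∀ x, ‖φ x‖ ≤ 1) :
    ENNReal.ofReal (∫ x in cell d ℓ, u x * divergence φ x) ≤ totalVariation ℓ u :=
  le_iSup_of_le φ <| le_iSup_of_le hφ <| le_iSup_of_le hp <| le_iSup_of_le hb le_rfl

/-- For each test function the integral is linear in the direction, and a supremum of linear
functionals is subadditive. Coercivity of the limit energy uses this for a direction and its
reflection. -/
lemma directionalVariation_add_le (hu : Measurable u) (hb : ∀ x, |u x| ≤ 1)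
    (w w' : EuclideanSpace ℝ (Fin d)) :
    directionalVariation ℓ (w + w') u ≤
      directionalVariation ℓ w u + directionalVariation ℓ w' u := by
  refine iSup_le fun φ => iSup_le fun hφ => iSup_le fun hp => iSup_le fun hφb => ?_
  have hint := fun w => integrableOn_cell_mul hu hb
    (integrableOn_cell (ℓ := ℓ) (continuous_fderiv_apply_const hφ w))
  simp only [map_add, mul_add]
  rw [integral_add (hint w) (hint w')]
  exact ENNReal.ofReal_add_le.trans
    (add_le_add (le_directionalVariation w hφ hp hφb) (le_directionalVariation w' hφ hp hφb))

lemma directionalVariation_smul {c : ℝ} (hc : 0 ≤ c) (w : EuclideanSpace ℝ (Fin d)) :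
    directionalVariation ℓ (c • w) u = ENNReal.ofReal c * directionalVariation ℓ w u := by
  simp only [directionalVariation, ENNReal.mul_iSup, map_smul, smul_eq_mul, mul_left_comm _ c,
    integral_const_mul, ENNReal.ofReal_mul hc]

lemma directionalVariation_neg (w : EuclideanSpace ℝ (Fin d)) :
    directionalVariation ℓ (-w) u = directionalVariation ℓ w u := by
  have key : ∀ w : EuclideanSpace ℝ (Fin d),
      directionalVariation ℓ (-w) u ≤ directionalVariation ℓ w u := by
    intro w
    refine iSup_le fun φ => iSup_le fun hφ => iSup_le fun hp => iSup_le fun hφb => ?_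
    have := le_directionalVariation (u := u) w (φ := fun x => -φ x) hφ.neg (hp.comp _)
      (by simpa using hφb)
    simpa [fderiv_fun_neg] using this
  exact le_antisymm (key w) (by simpa using key (-w))

/-- The field `φ w` is admissible for the total variation and its divergence is the derivative of
`φ` along `w`. -/
lemma directionalVariation_le_totalVariation {w : EuclideanSpace ℝ (Fin d)} (hw : ‖w‖ ≤ 1) :
    directionalVariation ℓ w u ≤ totalVariation ℓ u := by
  refine iSup_le fun φ => iSup_le fun hφ => iSup_le fun hp => iSup_le fun hφb => ?_
  have hdiv : divergence (fun x => φ x • w) = fun x => fderiv ℝ φ x w := by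
    ext x
    have hd : DifferentiableAt ℝ φ x := hφ.differentiable one_ne_zero x
    have hw : w = ∑ i, w i • EuclideanSpace.single i (1 : ℝ) := by
      simpa using ((EuclideanSpace.basisFun (Fin d) ℝ).sum_repr w).symm
    rw [divergence, fderiv_smul_const hd]
    conv_rhs => rw [hw]
    simp [mul_comm]
  have := le_totalVariation (u := u) (φ := fun x => φ x • w) (hφ.smul contDiff_const)
    (hp.comp fun a => a • w) (fun x => by
      rw [norm_smul]
      exact mul_le_one₀ (hφb x) (norm_nonneg _) hw)
  rwa [hdiv] at this

lemma directionalVariation_le (z : EuclideanSpace ℝ (Fin d)) :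
    directionalVariation ℓ z u ≤ ENNReal.ofReal ‖z‖ * totalVariation ℓ u := by
  have hz : z = ‖z‖ • (‖z‖⁻¹ • z) := by
    rcases eq_or_ne z 0 with rfl | h
    · simp
    · rw [smul_inv_smul₀ (norm_ne_zero_iff.2 h)]
  conv_lhs => rw [hz]
  rw [directionalVariation_smul (norm_nonneg z)]
  gcongr
  refine directionalVariation_le_totalVariation ?_
  rw [norm_smul, norm_inv, norm_norm]
  exact inv_mul_le_one

/-- Each component of a field of norm at most one is an admissible scalar test function. -/
lemma totalVariation_le_sum (hu : Measurable u) (hb : ∀ x, |u x| ≤ 1) :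
    totalVariation ℓ u ≤ ∑ i, directionalVariation ℓ (EuclideanSpace.single i 1) u := by
  refine iSup_le fun φ => iSup_le fun hφ => iSup_le fun hp => iSup_le fun hφb => ?_
  have hφi : ∀ i, ContDiff ℝ 1 fun x => φ x i := fun i =>
    contDiff_euclidean.1 hφ i
  have hdiv : ∀ x, divergence φ x =
      ∑ i, fderiv ℝ (fun x => φ x i) x (EuclideanSpace.single i 1) := by
    intro x
    refine Finset.sum_congr rfl fun i _ => ?_
    have hd : HasFDerivAt φ (fderiv ℝ φ x) x := (hφ.differentiable one_ne_zero x).hasFDerivAt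
    have := ((EuclideanSpace.proj (𝕜 := ℝ) i).hasFDerivAt (x := φ x)).comp x hd
    rw [show (fun x => φ x i) = EuclideanSpace.proj (𝕜 := ℝ) i ∘ φ from rfl, this.fderiv]
    rfl
  simp only [hdiv, Finset.mul_sum]
  rw [integral_finsetSum _ fun i _ => integrableOn_cell_mul hu hb
    (integrableOn_cell (continuous_fderiv_apply_const (hφi i) _))]
  calc ENNReal.ofReal (∑ i, ∫ x in cell d ℓ, u x *
          fderiv ℝ (fun x => φ x i) x (EuclideanSpace.single i 1))
      ≤ ∑ i, ENNReal.ofReal (∫ x in cell d ℓ, u x *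
          fderiv ℝ (fun x => φ x i) x (EuclideanSpace.single i 1)) :=
        Finset.le_sum_of_subadditive _ ENNReal.ofReal_zero.le (fun _ _ => ENNReal.ofReal_add_le) _ _
    _ ≤ _ := Finset.sum_le_sum fun i _ => le_directionalVariation _ (hφi i)
        (hp.comp fun y => y i)
        fun x => (PiLp.norm_apply_le (φ x) i).trans (hφb x)

/-- A supremum of continuous functions of the direction. It serves to make the integrand of the
limit energy measurable. -/
lemma lowerSemicontinuous_directionalVariation (hu : Measurable u) (hb : ∀ x, |u x| ≤ 1) :
    LowerSemicontinuous fun w => directionalVariation ℓ w u := by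
  refine lowerSemicontinuous_iSup fun φ => lowerSemicontinuous_iSup fun hφ =>
    lowerSemicontinuous_iSup fun hp => lowerSemicontinuous_iSup fun hφb => ?_
  refine Continuous.lowerSemicontinuous (ENNReal.continuous_ofReal.comp ?_)
  have hint : IntegrableOn (fun x => u x • fderiv ℝ φ x) (cell d ℓ) :=
    (integrableOn_cell (hφ.continuous_fderiv one_ne_zero)).bdd_smul 1 hu.aestronglyMeasurable
      (Eventually.of_forall hb)
  have : (fun w => ∫ x in cell d ℓ, u x * fderiv ℝ φ x w) =
      fun w => (∫ x in cell d ℓ, u x • fderiv ℝ φ x) w := by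
    ext w
    rw [ContinuousLinearMap.integral_apply hint]
    simp
  rw [this]
  fun_prop

lemma tendsto_integral_cell_mul {un : ℕ → EuclideanSpace ℝ (Fin d) → ℝ}
    (hun : ∀ n, Measurable (un n)) (hbn : ∀ n x, |un n x| ≤ 1)
    (h : ∀ᵐ x, Tendsto (fun n => un n x) atTop (𝓝 (u x)))
    {g : EuclideanSpace ℝ (Fin d) → ℝ} (hg : IntegrableOn g (cell d ℓ)) :
    Tendsto (fun n => ∫ x in cell d ℓ, un n x * g x) atTop
      (𝓝 (∫ x in cell d ℓ, u x * g x)) := by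
  refine tendsto_integral_of_dominated_convergence (fun x => |g x|)
    (fun n => (hun n).aestronglyMeasurable.mul hg.1) hg.abs
    (fun n => Eventually.of_forall fun x => ?_) ?_
  · rw [norm_mul]
    exact mul_le_of_le_one_left (norm_nonneg _) (hbn n x)
  · filter_upwards [ae_restrict_of_ae h] with x hx using hx.mul_const _

/-- For a fixed test function the integral passes to the limit by dominated convergence; the
supremum over test functions is then lower semicontinuous. -/
lemma directionalVariation_le_liminf {un : ℕ → EuclideanSpace ℝ (Fin d) → ℝ}
    (hun : ∀ n, Measurable (un n)) (hbn : ∀ n x, |un n x| ≤ 1)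
    (h : ∀ᵐ x, Tendsto (fun n => un n x) atTop (𝓝 (u x))) (w : EuclideanSpace ℝ (Fin d)) :
    directionalVariation ℓ w u ≤ liminf (fun n => directionalVariation ℓ w (un n)) atTop := by
  refine iSup_le fun φ => iSup_le fun hφ => iSup_le fun hp => iSup_le fun hφb => ?_
  have := tendsto_integral_cell_mul (ℓ := ℓ) hun hbn h
    (integrableOn_cell (continuous_fderiv_apply_const hφ w))
  rw [← (ENNReal.tendsto_ofReal this).liminf_eq]
  exact liminf_le_liminf (Eventually.of_forall fun n => le_directionalVariation w hφ hp hφb)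

lemma totalVariation_le_liminf {un : ℕ → EuclideanSpace ℝ (Fin d) → ℝ}
    (hun : ∀ n, Measurable (un n)) (hbn : ∀ n x, |un n x| ≤ 1)
    (h : ∀ᵐ x, Tendsto (fun n => un n x) atTop (𝓝 (u x))) :
    totalVariation ℓ u ≤ liminf (fun n => totalVariation ℓ (un n)) atTop := by
  refine iSup_le fun φ => iSup_le fun hφ => iSup_le fun hp => iSup_le fun hφb => ?_
  have := tendsto_integral_cell_mul (ℓ := ℓ) hun hbn h
    (integrableOn_cell (continuous_divergence hφ))
  rw [← (ENNReal.tendsto_ofReal this).liminf_eq]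
  exact liminf_le_liminf (Eventually.of_forall fun n => le_totalVariation hφ hp hφb)

end Variation

/-! ### The `L^1` modulus of continuity of translations. -/

section Translation

open scoped Convolution

variable {d : ℕ} {ℓ : ℝ} {u : EuclideanSpace ℝ (Fin d) → ℝ}

/-- A bounded periodic function is an a.e. limit of periodic `C^1` functions with the same bound. -/
lemma exists_contDiff_tendsto {s : EuclideanSpace ℝ (Fin d) → ℝ} (hs : Measurable s)
    (hp : IsPeriodic ℓ s) (hb : ∀ x, |s x| ≤ 1) :
    ∃ φ : ℕ → EuclideanSpace ℝ (Fin d) → ℝ, (∀ n, ContDiff ℝ 1 (φ n)) ∧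
      (∀ n, IsPeriodic ℓ (φ n)) ∧ (∀ n x, |φ n x| ≤ 1) ∧
      ∀ᵐ x, Tendsto (fun n => φ n x) atTop (𝓝 (s x)) := by
  -- Mollification: the outer radius stays twice the inner one, and this bounded ratio gives a.e.
  -- convergence for a merely locally integrable function.
  let ρ : ℕ → ContDiffBump (0 : EuclideanSpace ℝ (Fin d)) := fun n =>
    ⟨1 / ((n : ℝ) + 1), 2 * (1 / ((n : ℝ) + 1)), by positivity, by
      have : 0 < 1 / ((n : ℝ) + 1) := by positivity
      linarith⟩
  have hloc : LocallyIntegrable s volume := by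
    refine (locallyIntegrable_const (1 : ℝ)).mono hs.aestronglyMeasurable
      (Eventually.of_forall fun x => ?_)
    simpa using hb x
  refine ⟨fun n => (ρ n).normed volume ⋆[ContinuousLinearMap.lsmul ℝ ℝ, volume] s,
    fun n => ?_, fun n i x => ?_, fun n x => ?_, ?_⟩
  · exact (ρ n).hasCompactSupport_normed.contDiff_convolution_left _
      ((ρ n).contDiff_normed (n := 1)) hloc
  · simp only [convolution_def]
    refine integral_congr_ae (Eventually.of_forall fun t => ?_)
    simp only [add_sub_right_comm x _ t, hp i]
  · simp only [convolution_def, ContinuousLinearMap.lsmul_apply, smul_eq_mul]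
    rw [← Real.norm_eq_abs, ← (ρ n).integral_normed (μ := (volume : Measure (EuclideanSpace ℝ (Fin d))))]
    refine norm_integral_le_of_norm_le ((ρ n).integrable_normed (μ := volume)) (Eventually.of_forall fun t => ?_)
    rw [norm_mul, Real.norm_of_nonneg ((ρ n).nonneg_normed t)]
    exact mul_le_of_le_one_right ((ρ n).nonneg_normed t) (hb _)
  · refine ContDiffBump.ae_convolution_tendsto_right_of_locallyIntegrable (K := 2) ?_
      (Eventually.of_forall fun n => le_rfl) hloc
    rw [← mul_zero (2 : ℝ)]
    exact (tendsto_one_div_add_atTop_nhds_zero_nat (𝕜 := ℝ)).const_mul 2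

/-- Periodicity moves the difference onto the test function: `φ(x - z) - φ(x)` is the integral over
`t` in `[0, 1]` of the derivative along `z` of `-φ(· - t z)`. Each of these shifted functions is
itself admissible, so Fubini gives an average of quantities bounded by the variation. -/
lemma ofReal_integral_translate_sub_mul_le (hℓ : 0 < ℓ) (hu : Measurable u)
    (hp : IsPeriodic ℓ u) (hb : ∀ x, |u x| ≤ 1) (z : EuclideanSpace ℝ (Fin d))
    {φ : EuclideanSpace ℝ (Fin d) → ℝ} (hφ : ContDiff ℝ 1 φ) (hφp : IsPeriodic ℓ φ)
    (hφb : ∀ x, |φ x| ≤ 1) :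
    ENNReal.ofReal (∫ x in cell d ℓ, (u (x + z) - u x) * φ x) ≤ directionalVariation ℓ z u := by
  rcases eq_or_ne (directionalVariation ℓ z u) ⊤ with htop | htop
  · simp [htop]
  have hu' : Measurable fun x => u (x + z) := hu.comp (measurable_add_const z)
  have h1 : ∫ x in cell d ℓ, (u (x + z) - u x) * φ x =
      ∫ x in cell d ℓ, u x * (φ (x - z) - φ x) := by
    have hI := integrableOn_cell_mul (ℓ := ℓ) hu hb (integrableOn_cell hφ.continuous)
    have hI' := integrableOn_cell_mul (ℓ := ℓ) hu' (fun x => hb _)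
      (integrableOn_cell hφ.continuous)
    have hI'' := integrableOn_cell_mul (ℓ := ℓ) hu hb
      (integrableOn_cell (f := fun x => φ (x - z)) (hφ.continuous.comp (continuous_sub_right z)))
    have hshift := setIntegral_cell_add hℓ (hp.comp₂ (hφp.comp_sub_right z) (· * ·)) z
    simp only [add_sub_cancel_right] at hshift
    simp only [sub_mul, mul_sub]
    rw [integral_sub hI' hI, integral_sub hI'' hI, hshift]
  have h2 : ∀ x, φ (x - z) - φ x =
      ∫ t in (0 : ℝ)..1, fderiv ℝ (fun y => -φ (y - t • z)) x z := by
    intro x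
    have hder : ∀ t : ℝ, HasDerivAt (fun t : ℝ => φ (x - t • z))
        (fderiv ℝ (fun y => -φ (y - t • z)) x z) t := by
      intro t
      have e1 : HasDerivAt (fun t : ℝ => x - t • z) (-z) t := by
        simpa using ((hasDerivAt_id t).smul_const z).const_sub x
      have e2 := ((hφ.differentiable one_ne_zero (x - t • z)).hasFDerivAt).comp_hasDerivAt t e1
      have e3 : fderiv ℝ (fun y => -φ (y - t • z)) x z = fderiv ℝ φ (x - t • z) (-z) := by
        rw [fderiv_fun_neg, fderiv_comp_sub]
        simp
      rw [e3]
      exact e2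
    rw [intervalIntegral.integral_eq_sub_of_hasDerivAt (fun t _ => hder t)]
    · simp
    · refine Continuous.intervalIntegrable ?_ _ _
      simp only [fderiv_fun_neg, fderiv_comp_sub]
      have := hφ.continuous_fderiv one_ne_zero
      fun_prop
  have hcont : Continuous fun p : EuclideanSpace ℝ (Fin d) × ℝ =>
      fderiv ℝ (fun y => -φ (y - p.2 • z)) p.1 z := by
    simp only [fderiv_fun_neg, fderiv_comp_sub]
    have := hφ.continuous_fderiv one_ne_zero
    fun_prop
  have hint : Integrable (fun p : EuclideanSpace ℝ (Fin d) × ℝ =>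
      u p.1 * fderiv ℝ (fun y => -φ (y - p.2 • z)) p.1 z)
      ((volume.restrict (cell d ℓ)).prod (volume.restrict (Ioc 0 1))) := by
    refine Integrable.bdd_mul (c := 1) ?_ (hu.comp measurable_fst).aestronglyMeasurable
      (Eventually.of_forall fun p => hb _)
    rw [Measure.prod_restrict]
    exact (hcont.continuousOn.integrableOn_compact
      (isBounded_cell.isCompact_closure.prod isCompact_Icc)).mono_set
      (prod_mono subset_closure Ioc_subset_Icc_self)
  have h3 : ∫ x in cell d ℓ, u x * (φ (x - z) - φ x) =
      ∫ t in Ioc (0 : ℝ) 1, ∫ x in cell d ℓ, u x * fderiv ℝ (fun y => -φ (y - t • z)) x z := by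
    rw [← integral_integral_swap hint]
    refine integral_congr_ae (Eventually.of_forall fun x => ?_)
    simp only
    rw [h2, integral_const_mul, intervalIntegral.integral_of_le zero_le_one]
  rw [h1, h3]
  refine (ENNReal.ofReal_le_iff_le_toReal htop).2 ?_
  calc ∫ t in Ioc (0 : ℝ) 1, ∫ x in cell d ℓ, u x * fderiv ℝ (fun y => -φ (y - t • z)) x z
      ≤ ∫ t in Ioc (0 : ℝ) 1, (directionalVariation ℓ z u).toReal := by
        refine integral_mono hint.integral_prod_right (integrable_const _) fun t => ?_
        refine (ENNReal.ofReal_le_iff_le_toReal htop).1 ?_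
        refine le_directionalVariation z ?_ ((hφp.comp_sub_right _).comp _) fun x => ?_
        · exact (hφ.comp (contDiff_id.sub contDiff_const)).neg
        · simpa using hφb _
    _ = _ := by simp

/-- Translating `u` by `z` changes it in `L^1` of the torus by at most the variation of `u`
along `z`. -/
lemma lintegral_translate_sub_le (hℓ : 0 < ℓ) (hu : Measurable u)
    (hp : IsPeriodic ℓ u) (hb : ∀ x, |u x| ≤ 1) (z : EuclideanSpace ℝ (Fin d)) :
    ∫⁻ x in cell d ℓ, ENNReal.ofReal |u (x + z) - u x| ≤ directionalVariation ℓ z u := by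
  set g : EuclideanSpace ℝ (Fin d) → ℝ := fun x => u (x + z) - u x with hg
  have hgm : Measurable g := (hu.comp (measurable_add_const z)).sub hu
  have hgp : IsPeriodic ℓ g := (hp.comp_add_right z).comp₂ hp (· - ·)
  have hgb : ∀ x, |g x| ≤ 2 := fun x =>
    (abs_sub _ _).trans (by linarith [hb (x + z), hb x])
  have hgi : IntegrableOn g (cell d ℓ) :=
    Measure.integrableOn_of_bounded volume_cell_ne_top hgm.aestronglyMeasurable
      (Eventually.of_forall hgb)
  -- By duality the `L^1` norm of `g` is attained on its sign, which is approximated by smooth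
  -- periodic test functions.
  obtain ⟨φ, hφ, hφp, hφb, hlim⟩ := exists_contDiff_tendsto
    (s := fun x => if 0 ≤ g x then 1 else -1)
    (Measurable.ite (measurableSet_le measurable_const hgm) measurable_const measurable_const)
    (hgp.comp fun a => if 0 ≤ a then (1 : ℝ) else -1)
    (fun x => by split_ifs <;> simp)
  have hT : Tendsto (fun n => ∫ x in cell d ℓ, g x * φ n x) atTop
      (𝓝 (∫ x in cell d ℓ, |g x|)) := by
    refine tendsto_integral_of_dominated_convergence (fun x => |g x|)
      (fun n => hgm.aestronglyMeasurable.mul (hφ n).continuous.aestronglyMeasurable) hgi.abs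
      (fun n => Eventually.of_forall fun x => ?_) ?_
    · rw [norm_mul]
      exact mul_le_of_le_one_right (norm_nonneg _) (hφb n x)
    · filter_upwards [ae_restrict_of_ae hlim] with x hx
      convert hx.const_mul (g x) using 2
      split_ifs with h
      · rw [abs_of_nonneg h, mul_one]
      · rw [abs_of_neg (not_le.1 h)]; ring
  rw [← ofReal_integral_eq_lintegral_ofReal hgi.abs (Eventually.of_forall fun x => abs_nonneg _)]
  exact le_of_tendsto' (ENNReal.tendsto_ofReal hT) fun n =>
    ofReal_integral_translate_sub_mul_le hℓ hu hp hb z (hφ n) (hφp n) (hφb n)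

end Translation

/-! ### Weak sequential compactness of bounded sequences. -/

section WeakCompactness

/-- A uniformly bounded sequence on a finite measure space has a subsequence whose integrals over
every measurable set converge. -/
lemma exists_subseq_tendsto_setIntegral {α : Type*} [MeasurableSpace α]
    [MeasurableSpace.CountablyGenerated α] (μ : Measure α) [IsFiniteMeasure μ]
    {un : ℕ → α → ℝ} (hun : ∀ n, Measurable (un n)) (hbn : ∀ n x, |un n x| ≤ 1) :
    ∃ ψ : ℕ → ℕ, StrictMono ψ ∧ ∀ s, MeasurableSet s →
      ∃ L, Tendsto (fun n => ∫ x in s, un (ψ n) x ∂μ) atTop (𝓝 L) := by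
  have hmem : ∀ n, MemLp (un n) 2 μ := fun n =>
    MemLp.of_bound (hun n).aestronglyMeasurable 1 (Eventually.of_forall (hbn n))
  have hfact : Fact ((2 : ℝ≥0∞) ≠ ⊤) := ⟨by simp⟩
  -- The functions are bounded in `L^2`, identified with its dual. Countable generation makes `L^2`
  -- separable, so the closed ball is weak-* sequentially compact; testing on indicators gives the
  -- integrals over sets.
  let D := InnerProductSpace.toDual ℝ (Lp ℝ 2 μ)
  set r : ℝ := μ.real univ ^ (2 : ℝ≥0∞).toReal⁻¹ * 1
  have hball : ∀ n, StrongDual.toWeakDual (D (hmem n).toLp) ∈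
      WeakDual.toStrongDual ⁻¹' Metric.closedBall (0 : StrongDual ℝ (Lp ℝ 2 μ)) r := by
    intro n
    simp only [mem_preimage, mem_closedBall_zero_iff]
    change ‖D (hmem n).toLp‖ ≤ r
    rw [LinearIsometryEquiv.norm_map]
    refine Lp.norm_le_of_ae_bound zero_le_one ?_
    filter_upwards [(hmem n).coeFn_toLp] with x hx
    rw [hx]
    exact hbn n x
  obtain ⟨L, -, ψ, hψ, hL⟩ := WeakDual.isSeqCompact_closedBall ℝ _ _ _ hball
  refine ⟨ψ, hψ, fun s hs => ⟨L (indicatorConstLp 2 hs (measure_ne_top μ s) 1), ?_⟩⟩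
  have := (WeakBilin.eval_continuous (topDualPairing ℝ (Lp ℝ 2 μ))
    (indicatorConstLp 2 hs (measure_ne_top μ s) 1)).tendsto L |>.comp hL
  refine this.congr fun n => ?_
  change inner ℝ (hmem (ψ n)).toLp (indicatorConstLp 2 hs (measure_ne_top μ s) (1 : ℝ)) = _
  rw [real_inner_comm, L2.inner_indicatorConstLp_one]
  exact integral_congr_ae (ae_restrict_of_ae (hmem (ψ n)).coeFn_toLp)

end WeakCompactness

/-! ### Strong compactness under a perimeter bound. -/

section Compactness

variable {d : ℕ} {ℓ : ℝ}

lemma integral_ball_eq_integral_ball_zero (u : EuclideanSpace ℝ (Fin d) → ℝ)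
    (x : EuclideanSpace ℝ (Fin d)) (h : ℝ) :
    ∫ z in Metric.ball 0 h, u (x + z) = ∫ y in Metric.ball x h, u y := by
  have := (measurePreserving_add_left volume x).setIntegral_preimage_emb
    (measurableEmbedding_addLeft x) u (Metric.ball x h)
  rw [← this]
  simp

lemma measurable_translate_uncurry {u : EuclideanSpace ℝ (Fin d) → ℝ} (hu : Measurable u) :
    Measurable fun p : EuclideanSpace ℝ (Fin d) × EuclideanSpace ℝ (Fin d) =>
      u (p.1 + p.2) := hu.comp (measurable_fst.add measurable_snd)

lemma measurable_ball_average {u : EuclideanSpace ℝ (Fin d) → ℝ} (hu : Measurable u) (h : ℝ) :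
    Measurable fun x => ⨍ z in Metric.ball 0 h, u (x + z) := by
  simp only [average]
  exact (StronglyMeasurable.integral_prod_right
    (measurable_translate_uncurry hu).stronglyMeasurable).measurable

/-- The `L^1` distance of `u` to its averages over balls of radius `h` is at most `h |∇u|(𝕋_ℓ)`. -/
lemma lintegral_sub_ball_average_le (hℓ : 0 < ℓ) {u : EuclideanSpace ℝ (Fin d) → ℝ}
    (hu : Measurable u) (hp : IsPeriodic ℓ u) (hb : ∀ x, |u x| ≤ 1) {h : ℝ} (hh : 0 < h) :
    ∫⁻ x in cell d ℓ, ‖u x - ⨍ z in Metric.ball 0 h, u (x + z)‖ₑ ≤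
      ENNReal.ofReal h * totalVariation ℓ u := by
  -- With the uniform probability measure on the ball, `u` minus its average is a mean of
  -- translation differences, and Fubini applies the translation estimate to each `z`.
  set μ : Measure (EuclideanSpace ℝ (Fin d)) :=
    (volume (Metric.ball (0 : EuclideanSpace ℝ (Fin d)) h))⁻¹ •
      volume.restrict (Metric.ball 0 h) with hμ
  have hball0 : volume (Metric.ball (0 : EuclideanSpace ℝ (Fin d)) h) ≠ 0 :=
    (Metric.measure_ball_pos volume 0 hh).ne'
  have hballt : volume (Metric.ball (0 : EuclideanSpace ℝ (Fin d)) h) ≠ ⊤ :=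
    measure_ball_lt_top.ne
  have : IsProbabilityMeasure μ := ⟨by
    simp [hμ, ENNReal.inv_mul_cancel hball0 hballt]⟩
  have hav : ∀ x, ⨍ z in Metric.ball 0 h, u (x + z) = ∫ z, u (x + z) ∂μ := fun x => by
    simp [average, hμ]
  have hm : Measurable fun p : EuclideanSpace ℝ (Fin d) × EuclideanSpace ℝ (Fin d) =>
      ENNReal.ofReal |u (p.1 + p.2) - u p.1| :=
    ((measurable_translate_uncurry hu).sub (hu.comp measurable_fst)).abs.ennreal_ofReal
  calc ∫⁻ x in cell d ℓ, ‖u x - ⨍ z in Metric.ball 0 h, u (x + z)‖ₑ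
      ≤ ∫⁻ x in cell d ℓ, ∫⁻ z, ENNReal.ofReal |u (x + z) - u x| ∂μ := by
        refine lintegral_mono fun x => ?_
        have hint : Integrable (fun z => u (x + z)) μ :=
          Integrable.of_bound (hu.comp (measurable_const_add x)).aestronglyMeasurable 1
            (Eventually.of_forall fun z => hb _)
        have : u x - ⨍ z in Metric.ball 0 h, u (x + z) = -∫ z, (u (x + z) - u x) ∂μ := by
          rw [integral_sub hint (integrable_const _), hav]
          simp
        rw [this, enorm_neg]
        refine (enorm_integral_le_lintegral_enorm _).trans (le_of_eq ?_)
        simp only [Real.enorm_eq_ofReal_abs]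
    _ = ∫⁻ z, (∫⁻ x in cell d ℓ, ENNReal.ofReal |u (x + z) - u x|) ∂μ :=
        lintegral_lintegral_swap hm.aemeasurable
    _ ≤ ∫⁻ _z, ENNReal.ofReal h * totalVariation ℓ u ∂μ := by
        refine lintegral_mono_ae ?_
        have : ∀ᵐ z ∂μ, z ∈ Metric.ball (0 : EuclideanSpace ℝ (Fin d)) h :=
          Measure.ae_smul_measure (ae_restrict_mem measurableSet_ball) _
        filter_upwards [this] with z hz
        refine (lintegral_translate_sub_le hℓ hu hp hb z).trans
          ((directionalVariation_le z).trans ?_)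
        gcongr
        exact (mem_ball_zero_iff.1 hz).le
    _ = _ := by simp

/-- A sequence of bounded periodic functions with bounded variation has an a.e. convergent
subsequence. -/
lemma exists_subseq_ae_tendsto (hℓ : 0 < ℓ) {un : ℕ → EuclideanSpace ℝ (Fin d) → ℝ}
    (hun : ∀ n, Measurable (un n)) (hp : ∀ n, IsPeriodic ℓ (un n)) (hbn : ∀ n x, |un n x| ≤ 1)
    {B : ℝ≥0∞} (hB : B ≠ ⊤) (hTV : ∀ n, totalVariation ℓ (un n) ≤ B) :
    ∃ ψ : ℕ → ℕ, StrictMono ψ ∧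
      ∀ᵐ x, ∃ L, Tendsto (fun n => un (ψ n) x) atTop (𝓝 L) := by
  -- Large enough to contain every ball of radius at most one centred in the cell.
  set R : ℝ := √(d * ℓ ^ 2) + 1
  have : IsFiniteMeasure (volume.restrict (Metric.ball (0 : EuclideanSpace ℝ (Fin d)) R)) :=
    isFiniteMeasure_restrict.2 measure_ball_lt_top.ne
  obtain ⟨ψ, hψ, hlim⟩ := exists_subseq_tendsto_setIntegral
    (volume.restrict (Metric.ball (0 : EuclideanSpace ℝ (Fin d)) R)) hun hbn
  have hav : ∀ h, 0 < h → h ≤ 1 → ∀ x ∈ cell d ℓ,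
      ∃ L, Tendsto (fun n => ⨍ z in Metric.ball 0 h, un (ψ n) (x + z)) atTop (𝓝 L) := by
    intro h hh hh1 x hx
    obtain ⟨L, hL⟩ := hlim (Metric.ball x h) measurableSet_ball
    refine ⟨_, (hL.const_mul (volume.real (Metric.ball (0 : EuclideanSpace ℝ (Fin d)) h))⁻¹).congr
      fun n => ?_⟩
    rw [setAverage_eq, integral_ball_eq_integral_ball_zero, smul_eq_mul,
      Measure.restrict_restrict measurableSet_ball, inter_eq_self_of_subset_left]
    refine Metric.ball_subset_ball' ?_
    rw [dist_zero_right]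
    linarith [norm_le_of_mem_cell hx]
  have hmem : ∀ n, MemLp (un (ψ n)) 1 (volume.restrict (cell d ℓ)) := fun n =>
    MemLp.of_bound (hun _).aestronglyMeasurable 1 (Eventually.of_forall (hbn _))
  have hcauchy : CauchySeq fun n => (hmem n).toLp := by
    refine EMetric.cauchySeq_iff.2 fun ε hε => ?_
    -- At this radius every function of the sequence is within `ε/4` of its ball averages. The
    -- averages converge pointwise and are bounded by one, so they are Cauchy in `L^1`, which
    -- accounts for the remaining `ε/2`.
    obtain ⟨h, hh, hh1, hhε⟩ : ∃ h : ℝ, 0 < h ∧ h ≤ 1 ∧ ENNReal.ofReal h * B ≤ ε / 2 / 2 := by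
      have hlim0 : Tendsto (fun h : ℝ => ENNReal.ofReal h * B) (𝓝[>] 0) (𝓝 0) := by
        have : Tendsto (fun h : ℝ => ENNReal.ofReal h * B) (𝓝 0) (𝓝 (ENNReal.ofReal 0 * B)) :=
          ENNReal.Tendsto.mul_const (ENNReal.tendsto_ofReal tendsto_id) (Or.inr hB)
        rw [ENNReal.ofReal_zero, zero_mul] at this
        exact this.mono_left nhdsWithin_le_nhds
      have hε4 : 0 < ε / 2 / 2 := ENNReal.div_pos (ENNReal.div_pos hε.ne' (by simp)).ne' (by simp)
      obtain ⟨h, h1, h2⟩ := ((hlim0.eventually_lt_const hε4).and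
        (Ioc_mem_nhdsGT (zero_lt_one (α := ℝ)))).exists
      exact ⟨h, h2.1, h2.2, h1.le⟩
    set a : ℕ → EuclideanSpace ℝ (Fin d) → ℝ := fun n x =>
      ⨍ z in Metric.ball 0 h, un (ψ n) (x + z)
    have ham : ∀ n, Measurable (a n) := fun n => measurable_ball_average (hun _) h
    have hab : ∀ n x, |a n x| ≤ 1 := by
      intro n x
      have hI := norm_setIntegral_le_of_norm_le_const (f := fun z => un (ψ n) (x + z)) (C := 1)
        (measure_ball_lt_top (μ := volume) (x := (0 : EuclideanSpace ℝ (Fin d))) (r := h))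
        fun z _ => hbn _ _
      simp only [a]
      rw [setAverage_eq, ← Real.norm_eq_abs, norm_smul, norm_inv, Real.norm_of_nonneg
        measureReal_nonneg]
      refine inv_mul_le_one_of_le₀ ?_ measureReal_nonneg
      simpa using hI
    have hpair : Tendsto (fun p : ℕ × ℕ => ∫⁻ x in cell d ℓ, ‖a p.1 x - a p.2 x‖ₑ) atTop
        (𝓝 0) := by
      rw [← lintegral_zero (μ := volume.restrict (cell d ℓ))]
      refine tendsto_lintegral_filter_of_dominated_convergence (fun _ => 2)
        (Eventually.of_forall fun p => ((ham _).sub (ham _)).enorm)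
        (Eventually.of_forall fun p => Eventually.of_forall fun x => ?_) ?_ ?_
      · refine enorm_sub_le.trans ?_
        rw [← one_add_one_eq_two]
        gcongr <;>
        · rw [Real.enorm_eq_ofReal_abs]
          exact ENNReal.ofReal_le_one.2 (hab _ _)
      · simp [volume_cell_ne_top, ENNReal.mul_eq_top]
      · filter_upwards [ae_restrict_mem measurableSet_cell] with x hx
        obtain ⟨L, hL⟩ := hav h hh hh1 x hx
        have h1 : Tendsto (fun p : ℕ × ℕ => a p.1 x - a p.2 x) atTop (𝓝 (L - L)) := by
          rw [← prod_atTop_atTop_eq]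
          exact (hL.comp tendsto_fst).sub (hL.comp tendsto_snd)
        simpa using h1.enorm
    have hε2 : 0 < ε / 2 := ENNReal.div_pos hε.ne' (by simp)
    obtain ⟨N, hN⟩ := eventually_atTop.1 (hpair.eventually_lt_const hε2)
    refine ⟨max N.1 N.2, fun m hm n hn => ?_⟩
    have hmn := hN (m, n) ⟨(le_max_left _ _).trans hm, (le_max_right _ _).trans hn⟩
    have hone' : ∀ k, ∫⁻ x in cell d ℓ, ‖un (ψ k) x - a k x‖ₑ ≤ ENNReal.ofReal h * B := fun k =>
      (lintegral_sub_ball_average_le hℓ (hun _) (hp _) (hbn _) hh).trans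
        (mul_le_mul_right (hTV _) _)
    have hone : ∀ k, ∫⁻ x in cell d ℓ, ‖un (ψ k) x - a k x‖ₑ ≤ ε / 2 / 2 := fun k =>
      (hone' k).trans hhε
    rw [Lp.edist_toLp_toLp, eLpNorm_one_eq_lintegral_enorm]
    calc ∫⁻ x in cell d ℓ, ‖(un (ψ m) - un (ψ n)) x‖ₑ
        ≤ ∫⁻ x in cell d ℓ, (‖un (ψ m) x - a m x‖ₑ + ‖un (ψ n) x - a n x‖ₑ)
            + ‖a m x - a n x‖ₑ := by
          refine lintegral_mono fun x => ?_
          have : (un (ψ m) - un (ψ n)) x =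
              ((un (ψ m) x - a m x) - (un (ψ n) x - a n x)) + (a m x - a n x) := by
            simp only [Pi.sub_apply]; ring
          rw [this]
          exact (enorm_add_le _ _).trans (add_le_add_left enorm_sub_le _)
      _ = ((∫⁻ x in cell d ℓ, ‖un (ψ m) x - a m x‖ₑ) + ∫⁻ x in cell d ℓ, ‖un (ψ n) x - a n x‖ₑ)
            + ∫⁻ x in cell d ℓ, ‖a m x - a n x‖ₑ := by
          have e1 : Measurable fun x => ‖a m x - a n x‖ₑ := ((ham m).sub (ham n)).enorm
          have e2 : Measurable fun x => ‖un (ψ n) x - a n x‖ₑ := ((hun _).sub (ham n)).enorm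
          rw [lintegral_add_right _ e1, lintegral_add_right _ e2]
      _ < (ε / 2 / 2 + ε / 2 / 2) + ε / 2 := by
          refine ENNReal.add_lt_add_of_le_of_lt ?_ (add_le_add (hone m) (hone n)) hmn
          have hfin : ENNReal.ofReal h * B ≠ ⊤ := ENNReal.mul_ne_top ENNReal.ofReal_ne_top hB
          exact ENNReal.add_ne_top.2
            ⟨ne_top_of_le_ne_top hfin (hone' m), ne_top_of_le_ne_top hfin (hone' n)⟩
      _ = ε := by rw [ENNReal.add_halves, ENNReal.add_halves]
  obtain ⟨c, hc⟩ := cauchySeq_tendsto_of_complete hcauchy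
  obtain ⟨ns, hns, hae⟩ := (tendstoInMeasure_of_tendsto_Lp hc).exists_seq_tendsto_ae
  refine ⟨ψ ∘ ns, hψ.comp hns, ?_⟩
  refine ae_of_ae_cell hℓ (p := fun x => ∃ L, Tendsto (fun n => un ((ψ ∘ ns) n) x) atTop (𝓝 L))
    (fun i x => by simp only [hp _ i x]) ?_
  filter_upwards [hae, ae_all_iff.2 fun n => (hmem n).coeFn_toLp] with x hx hx'
  exact ⟨c x, hx.congr fun i => hx' (ns i)⟩

/-- Compactness of `BV(𝕋_ℓ; {0,1})`. -/
lemma exists_subseq_ae_tendsto_indicator (hℓ : 0 < ℓ) {un : ℕ → EuclideanSpace ℝ (Fin d) → ℝ}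
    (hun : ∀ n, un n ∈ BVIndicator d ℓ) {B : ℝ≥0∞} (hB : B ≠ ⊤)
    (hTV : ∀ n, totalVariation ℓ (un n) ≤ B) :
    ∃ ψ : ℕ → ℕ, StrictMono ψ ∧ ∃ u ∈ BVIndicator d ℓ,
      ∀ᵐ x, Tendsto (fun n => un (ψ n) x) atTop (𝓝 (u x)) := by
  have hbn : ∀ n x, |un n x| ≤ 1 := fun n x => by
    rcases (hun n).2.2.1 x with h | h <;> simp [h]
  obtain ⟨ψ, hψ, hae⟩ := exists_subseq_ae_tendsto hℓ (fun n => (hun n).1) (fun n => (hun n).2.1)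
    hbn hB hTV
  set A : Set (EuclideanSpace ℝ (Fin d)) := {x | ∀ᶠ n in atTop, un (ψ n) x = 1} with hA
  have hAm : MeasurableSet A := by
    have : A = ⋃ N, ⋂ n ≥ N, {x | un (ψ n) x = 1} := by
      ext x; simp [hA, eventually_atTop]
    rw [this]
    exact MeasurableSet.iUnion fun N => MeasurableSet.iInter fun n => MeasurableSet.iInter fun _ =>
      (hun _).1 (measurableSet_singleton 1)
  have hconv : ∀ᵐ x, Tendsto (fun n => un (ψ n) x) atTop (𝓝 (A.indicator 1 x)) := by
    filter_upwards [hae] with x ⟨L, hL⟩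
    by_cases hx : x ∈ A
    · rw [indicator_of_mem hx]
      exact tendsto_const_nhds.congr' (hx.mono fun n hn => by simp [hn])
    · rw [indicator_of_notMem hx]
      -- A sequence in `{0, 1}` with limit above `1/2` is eventually one, contradicting `x ∉ A`. So
      -- the limit is below one and the sequence is eventually zero.
      have hL2 : L ≤ 1 / 2 := by
        by_contra! hlt
        refine hx ((hL.eventually_const_lt hlt).mono fun n hn => ?_)
        rcases (hun (ψ n)).2.2.1 x with h | h
        · rw [h] at hn; norm_num at hn
        · exact h
      refine tendsto_const_nhds.congr' ((hL.eventually_lt_const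
        (show L < 1 by linarith)).mono fun n hn => ?_)
      rcases (hun (ψ n)).2.2.1 x with h | h
      · exact h.symm
      · exact absurd h hn.ne
  refine ⟨ψ, hψ, A.indicator 1, ⟨measurable_one.indicator hAm, fun i x => ?_, fun x => ?_, ?_⟩,
    hconv⟩
  · have : x + EuclideanSpace.single i ℓ ∈ A ↔ x ∈ A := by
      simp only [hA, mem_ofPred_eq, (hun _).2.1 i x]
    by_cases hx : x ∈ A
    · rw [indicator_of_mem hx, indicator_of_mem (this.2 hx)]; rfl
    · rw [indicator_of_notMem hx, indicator_of_notMem (fun h => hx (this.1 h))]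
  · by_cases hx : x ∈ A <;> simp [hx]
  · refine (totalVariation_le_liminf (fun n => (hun (ψ n)).1) (fun n => hbn _) hconv).trans_lt ?_
    refine lt_of_le_of_lt ?_ hB.lt_top
    exact liminf_le_of_le (by isBoundedDefault) fun b hb => by
      obtain ⟨n, hn⟩ := hb.exists
      exact hn.trans (hTV _)

end Compactness

/-! ### Radial kernels in polar coordinates. -/

section Kernels

variable {d : ℕ}

/-- Polar coordinates for radial functions. -/
lemma setLIntegral_fun_norm (hd : 1 ≤ d) {f : ℝ → ℝ≥0∞} (hf : Measurable f) {S : Set ℝ}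
    (hS : MeasurableSet S) :
    ∫⁻ z : EuclideanSpace ℝ (Fin d) in norm ⁻¹' S, f ‖z‖ =
      (d * volume (Metric.ball (0 : EuclideanSpace ℝ (Fin d)) 1)) *
        ∫⁻ r in S ∩ Ioi 0, f r * ENNReal.ofReal (r ^ (d - 1)) := by
  have : Nonempty (Fin d) := ⟨⟨0, hd⟩⟩
  have hfm : Measurable (S.indicator f) := hf.indicator hS
  have hE := (volume : Measure (EuclideanSpace ℝ (Fin d))).measurePreserving_homeomorphUnitSphereProd
  have hdim : Module.finrank ℝ (EuclideanSpace ℝ (Fin d)) = d := finrank_euclideanSpace_fin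
  calc ∫⁻ z : EuclideanSpace ℝ (Fin d) in norm ⁻¹' S, f ‖z‖
      = ∫⁻ z : EuclideanSpace ℝ (Fin d), S.indicator f ‖z‖ := by
        rw [← lintegral_indicator (measurable_norm hS)]
        rfl
    _ = ∫⁻ z : ({(0)}ᶜ : Set (EuclideanSpace ℝ (Fin d))), S.indicator f ‖z.1‖
          ∂((volume : Measure (EuclideanSpace ℝ (Fin d))).comap (↑)) := by
        rw [lintegral_subtype_comap (measurableSet_singleton _).compl
          (fun z : EuclideanSpace ℝ (Fin d) => S.indicator f ‖z‖), restrict_compl_singleton]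
    _ = ∫⁻ p, S.indicator f p.2 ∂((volume : Measure (EuclideanSpace ℝ (Fin d))).toSphere.prod
          (.volumeIoiPow (d - 1))) := by
        rw [hdim] at hE
        rw [← hE.lintegral_comp (f := fun p => S.indicator f p.2)
          (hfm.comp (measurable_subtype_coe.comp measurable_snd))]
        simp
    _ = (volume : Measure (EuclideanSpace ℝ (Fin d))).toSphere univ *
          ∫⁻ r : Ioi (0 : ℝ), S.indicator f r ∂(.volumeIoiPow (d - 1)) := by
        have hm : Measurable fun p : Metric.sphere (0 : EuclideanSpace ℝ (Fin d)) 1 × Ioi (0 : ℝ) =>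
            S.indicator f p.2 := hfm.comp (measurable_subtype_coe.comp measurable_snd)
        rw [lintegral_prod _ hm.aemeasurable]
        simp only [lintegral_const]
        rw [mul_comm]
    _ = _ := by
        have hm : Measurable fun r : Ioi (0 : ℝ) => S.indicator f r :=
          hfm.comp measurable_subtype_coe
        rw [Measure.toSphere_apply_univ, hdim, Measure.volumeIoiPow,
          lintegral_withDensity_eq_lintegral_mul _
            (measurable_subtype_coe.pow_const _).ennreal_ofReal
            hm]
        congr 1
        simp only [Pi.mul_apply]
        rw [lintegral_subtype_comap measurableSet_Ioi
          fun r : ℝ => ENNReal.ofReal (r ^ (d - 1)) * S.indicator f r,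
          ← Measure.restrict_restrict hS, ← lintegral_indicator hS]
        refine lintegral_congr fun r => ?_
        by_cases hr : r ∈ S <;> simp [hr, mul_comm]

lemma lintegral_ball_kernel (hd : 1 ≤ d) {κ : ℝ → ℝ≥0} (hκ : Measurable κ) :
    ∫⁻ z in Metric.ball (0 : EuclideanSpace ℝ (Fin d)) 1, (κ ‖z‖ : ℝ≥0∞) =
      (d * volume (Metric.ball (0 : EuclideanSpace ℝ (Fin d)) 1)) *
        ∫⁻ t in Ioo (0 : ℝ) 1, κ t * ENNReal.ofReal (t ^ (d - 1)) := by
  have h := setLIntegral_fun_norm hd hκ.coe_nnreal_ennreal (measurableSet_Iio (a := (1 : ℝ)))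
  rw [inter_comm, Ioi_inter_Iio] at h
  rw [← h]
  congr 2
  ext z
  simp

lemma lintegral_ball_kernel_ne_zero (hd : 1 ≤ d) {κ : ℝ → ℝ≥0} (hκ : Measurable κ)
    (hM : 0 < kernelMass d κ) :
    ∫⁻ z in Metric.ball (0 : EuclideanSpace ℝ (Fin d)) 1, (κ ‖z‖ : ℝ≥0∞) ≠ 0 := by
  rw [lintegral_ball_kernel hd hκ]
  refine mul_ne_zero (mul_ne_zero (by simpa using (by omega : d ≠ 0))
    (Metric.measure_ball_pos _ _ one_pos).ne') fun h => ?_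
  simp [kernelMass, h] at hM

/-- Tail condition on a radial kernel: `κ(|z|)/|z|` is integrable away from the origin. -/
def HasTail (d : ℕ) (κ : ℝ → ℝ≥0) : Prop :=
  ∀ δ : ℝ, 0 < δ → ∫⁻ z in (Metric.closedBall (0 : EuclideanSpace ℝ (Fin d)) δ)ᶜ,
    (κ ‖z‖ : ℝ≥0∞) * ENNReal.ofReal ‖z‖⁻¹ < ⊤

lemma hasTail_of_lintegral (hd : 1 ≤ d) {κ : ℝ → ℝ≥0} (hκ : Measurable κ)
    (h : ∀ δ : ℝ, 0 < δ → ∫⁻ r in Ioi δ, κ r *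
      ENNReal.ofReal (min (r ^ ((d : ℤ) - 2)) (r ^ ((d : ℤ) - 1))) < ⊤) : HasTail d κ := by
  intro δ hδ
  have hset : (Metric.closedBall (0 : EuclideanSpace ℝ (Fin d)) δ)ᶜ = norm ⁻¹' Ioi δ := by
    ext z; simp
  have hinter : Ioi δ ∩ Ioi (0 : ℝ) = Ioi δ := by
    rw [Ioi_inter_Ioi, sup_eq_left.2 hδ.le]
  have hm : Measurable fun r : ℝ => (κ r : ℝ≥0∞) * ENNReal.ofReal r⁻¹ :=
    hκ.coe_nnreal_ennreal.mul measurable_inv.ennreal_ofReal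
  rw [hset, setLIntegral_fun_norm hd hm measurableSet_Ioi, hinter]
  refine ENNReal.mul_lt_top (ENNReal.mul_lt_top (ENNReal.natCast_lt_top _)
    measure_ball_lt_top) ?_
  refine lt_of_le_of_lt ?_ (ENNReal.mul_lt_top (ENNReal.ofReal_lt_top (r := max 1 δ⁻¹)) (h δ hδ))
  rw [← lintegral_const_mul' _ _ ENNReal.ofReal_ne_top]
  refine setLIntegral_mono' measurableSet_Ioi fun r hr => ?_
  have hr0 : 0 < r := hδ.trans hr
  -- The left side is `r^(d-2)`. It is at most `δ⁻¹ r^(d-1)` since `r > δ`, so one constant handles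
  -- both terms of the minimum.
  have key : r⁻¹ * r ^ (d - 1) ≤
      max 1 δ⁻¹ * min (r ^ ((d : ℤ) - 2)) (r ^ ((d : ℤ) - 1)) := by
    have e1 : r⁻¹ * r ^ (d - 1) = r ^ ((d : ℤ) - 2) := by
      rw [← zpow_natCast, ← zpow_neg_one, ← zpow_add₀ hr0.ne']
      congr 1
      push_cast [Nat.cast_sub hd]
      ring
    have e2 : r ^ ((d : ℤ) - 1) = r * r ^ ((d : ℤ) - 2) := by
      rw [← zpow_one_add₀ hr0.ne']
      congr 1
      ring
    have hpos : 0 < r ^ ((d : ℤ) - 2) := zpow_pos hr0 _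
    rw [e1, e2, mul_min_of_nonneg _ _ (by positivity), le_min_iff]
    constructor
    · exact le_mul_of_one_le_left hpos.le (le_max_left _ _)
    · rw [← mul_assoc]
      refine le_mul_of_one_le_left hpos.le ?_
      calc 1 = δ⁻¹ * δ := (inv_mul_cancel₀ hδ.ne').symm
        _ ≤ max 1 δ⁻¹ * r := by
          gcongr
          · exact le_max_right _ _
          · exact le_of_lt hr
  calc (κ r : ℝ≥0∞) * ENNReal.ofReal r⁻¹ * ENNReal.ofReal (r ^ (d - 1))
      = κ r * ENNReal.ofReal (r⁻¹ * r ^ (d - 1)) := by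
        rw [ENNReal.ofReal_mul (by positivity), mul_assoc]
    _ ≤ κ r * ENNReal.ofReal (max 1 δ⁻¹ * min (r ^ ((d : ℤ) - 2)) (r ^ ((d : ℤ) - 1))) := by
        gcongr
    _ = _ := by
        rw [ENNReal.ofReal_mul (by positivity)]
        ring

/-- A kernel with positive mass in the unit ball has positive mass in an annulus. -/
lemma exists_annulus_kernel_ne_zero (hd : 1 ≤ d) {κ : ℝ → ℝ≥0}
    (h : ∫⁻ z in Metric.ball (0 : EuclideanSpace ℝ (Fin d)) 1, (κ ‖z‖ : ℝ≥0∞) ≠ 0) :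
    ∃ δ : ℝ, 0 < δ ∧ ∫⁻ z in Metric.ball (0 : EuclideanSpace ℝ (Fin d)) 1 \
      Metric.closedBall 0 δ, (κ ‖z‖ : ℝ≥0∞) ≠ 0 := by
  have : Nonempty (Fin d) := ⟨⟨0, hd⟩⟩
  by_contra! hcon
  refine h ?_
  -- If every annulus had zero mass, so would the ball, which is a countable union of annuli and a
  -- null point.
  have hunion : Metric.ball (0 : EuclideanSpace ℝ (Fin d)) 1 ⊆
      {0} ∪ ⋃ n : ℕ, Metric.ball 0 1 \ Metric.closedBall 0 (1 / ((n : ℝ) + 1)) := by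
    intro z hz
    rcases eq_or_ne z 0 with rfl | hz0
    · exact Or.inl rfl
    · obtain ⟨n, hn⟩ := exists_nat_one_div_lt (norm_pos_iff.2 hz0)
      exact Or.inr (mem_iUnion.2 ⟨n, hz, by simpa using hn⟩)
  refine le_antisymm ((lintegral_mono_set hunion).trans ?_) (zero_le)
  refine (lintegral_union_le _ _ _).trans ?_
  rw [setLIntegral_measure_zero _ _ (measure_singleton 0), zero_add]
  refine (lintegral_iUnion_le _ _).trans (le_of_eq ?_)
  exact ENNReal.tsum_eq_zero.2 fun n => hcon _ (by positivity)

end Kernels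

/-! ### A competitor of prescribed volume: the periodic slab. -/

section Slab

variable {n : ℕ} {ℓ : ℝ}

/-- The flux of a bounded `C^1` field through the boundary of a box is bounded. -/
lemma exists_integral_divergence_box_le {b : Fin (n + 1) → ℝ} (hb : 0 ≤ b) :
    ∃ C : ℝ, ∀ φ : EuclideanSpace ℝ (Fin (n + 1)) → EuclideanSpace ℝ (Fin (n + 1)),
      ContDiff ℝ 1 φ → (∀ x, ‖φ x‖ ≤ 1) →
        ∫ x in WithLp.ofLp ⁻¹' (univ.pi fun i => Ico 0 (b i)), divergence φ x ≤ C := by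
  -- Divergence theorem: each pair of opposite faces contributes at most twice its area, since the
  -- field has norm at most one.
  refine ⟨∑ i : Fin (n + 1), 2 * (1 * volume.real
    (Icc ((0 : Fin (n + 1) → ℝ) ∘ i.succAbove) (b ∘ i.succAbove))), fun φ hφ hφb => ?_⟩
  have hmp := PiLp.volume_preserving_toLp (Fin (n + 1))
  have h1 : ∫ x in WithLp.ofLp ⁻¹' (univ.pi fun i => Ico 0 (b i)), divergence φ x =
      ∫ y in Icc 0 b, divergence φ (WithLp.toLp 2 y) := by
    have hemb : MeasurableEmbedding (@WithLp.toLp 2 (Fin (n + 1) → ℝ)) :=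
      (MeasurableEquiv.toLp 2 (Fin (n + 1) → ℝ)).measurableEmbedding
    have := hmp.setIntegral_preimage_emb hemb (divergence φ)
      (WithLp.ofLp ⁻¹' (univ.pi fun i => Ico 0 (b i)))
    rw [← this, ← preimage_comp]
    refine setIntegral_congr_set ?_
    exact Measure.univ_pi_Ico_ae_eq_Icc (f := 0) (g := b)
  let L : (Fin (n + 1) → ℝ) →L[ℝ] EuclideanSpace ℝ (Fin (n + 1)) :=
    (PiLp.continuousLinearEquiv 2 ℝ (fun _ : Fin (n + 1) => ℝ)).symm.toContinuousLinearMap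
  have hder : ∀ y i, HasFDerivAt (fun y : Fin (n + 1) → ℝ => φ (WithLp.toLp 2 y) i)
      ((EuclideanSpace.proj i).comp ((fderiv ℝ φ (WithLp.toLp 2 y)).comp L)) y := by
    intro y i
    have e1 : HasFDerivAt (fun y : Fin (n + 1) → ℝ => WithLp.toLp 2 y) L y := L.hasFDerivAt
    have e2 := (hφ.differentiable one_ne_zero (WithLp.toLp 2 y)).hasFDerivAt.comp y e1
    exact ((EuclideanSpace.proj (𝕜 := ℝ) i).hasFDerivAt).comp y e2
  have hcont : ∀ i, Continuous fun y : Fin (n + 1) → ℝ => φ (WithLp.toLp 2 y) i := fun i =>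
    continuous_iff_continuousAt.2 fun y => (hder y i).continuousAt
  have hdiv : ∀ y : Fin (n + 1) → ℝ, divergence φ (WithLp.toLp 2 y) =
      ∑ i, ((EuclideanSpace.proj i).comp ((fderiv ℝ φ (WithLp.toLp 2 y)).comp L))
        (Pi.single i 1) := fun y => rfl
  rw [h1]
  simp only [hdiv]
  rw [integral_divergence_of_hasFDerivAt_off_countable' 0 b hb
    (fun i y => φ (WithLp.toLp 2 y) i) _ ∅ countable_empty (fun i => (hcont i).continuousOn)
    (fun y _ i => hder y i)]
  · refine Finset.sum_le_sum fun i _ => ?_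
    have hface : ∀ c : ℝ, |∫ x in Icc ((0 : Fin (n + 1) → ℝ) ∘ i.succAbove) (b ∘ i.succAbove),
        φ (WithLp.toLp 2 (i.insertNth c x)) i| ≤
          1 * volume.real (Icc ((0 : Fin (n + 1) → ℝ) ∘ i.succAbove) (b ∘ i.succAbove)) := fun c =>
      norm_setIntegral_le_of_norm_le_const isCompact_Icc.measure_lt_top
        fun x _ => (PiLp.norm_apply_le _ i).trans (hφb _)
    have h2 := (abs_le.1 (hface (b i))).2
    have h3 := (abs_le.1 (hface 0)).1
    have : ∀ A B D : ℝ, A ≤ D → -D ≤ B → A - B ≤ 2 * D := fun A B D h h' => by linarith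
    exact this _ _ _ h2 h3
  · simp only [← hdiv]
    exact ((continuous_divergence hφ).comp (PiLp.continuous_toLp 2 _)).continuousOn.integrableOn_Icc

/-- The indicator function of the periodic slab of volume fraction `θ`. -/
noncomputable def slab (n : ℕ) (ℓ θ : ℝ) (x : EuclideanSpace ℝ (Fin (n + 1))) : ℝ :=
  if Int.fract (x 0 / ℓ) < θ then 1 else 0

/-- The side lengths of the part of the slab in the periodicity cell. -/
noncomputable def slabSide (n : ℕ) (ℓ θ : ℝ) : Fin (n + 1) → ℝ := Fin.cons (θ * ℓ) fun _ => ℓ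

lemma measurableSet_slab (ℓ θ : ℝ) :
    MeasurableSet {x : EuclideanSpace ℝ (Fin (n + 1)) | Int.fract (x 0 / ℓ) < θ} := by
  have : Measurable fun x : EuclideanSpace ℝ (Fin (n + 1)) => x 0 / ℓ := by fun_prop
  exact measurableSet_lt (measurable_fract.comp this) measurable_const

lemma cell_inter_slab (hℓ : 0 < ℓ) {θ : ℝ} (hθ : θ ≤ 1) :
    {x : EuclideanSpace ℝ (Fin (n + 1)) | Int.fract (x 0 / ℓ) < θ} ∩ cell (n + 1) ℓ =
      WithLp.ofLp ⁻¹' (univ.pi fun i => Ico 0 (slabSide n ℓ θ i)) := by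
  have hfr : ∀ x : EuclideanSpace ℝ (Fin (n + 1)), x ∈ cell (n + 1) ℓ →
      Int.fract (x 0 / ℓ) = x 0 / ℓ := fun x hx =>
    Int.fract_eq_self.2 ⟨div_nonneg (hx 0).1 hℓ.le, (div_lt_one hℓ).2 (hx 0).2⟩
  ext x
  simp only [mem_inter_iff, mem_ofPred_eq, mem_preimage, Set.mem_pi, mem_univ, true_implies,
    Fin.forall_fin_succ, slabSide, Fin.cons_zero, Fin.cons_succ]
  constructor
  · rintro ⟨h, hx⟩
    rw [hfr x hx, div_lt_iff₀ hℓ] at h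
    exact ⟨⟨(hx 0).1, h⟩, fun i => hx i.succ⟩
  · rintro ⟨h0, hi⟩
    have hx : x ∈ cell (n + 1) ℓ := by
      refine Fin.cases ⟨h0.1, h0.2.trans_le (mul_le_of_le_one_left hℓ.le hθ)⟩ hi
    rw [hfr x hx, div_lt_iff₀ hℓ]
    exact ⟨h0.2, hx⟩

lemma setIntegral_cell_slab_mul (hℓ : 0 < ℓ) {θ : ℝ} (hθ : θ ≤ 1)
    (g : EuclideanSpace ℝ (Fin (n + 1)) → ℝ) :
    ∫ x in cell (n + 1) ℓ, slab n ℓ θ x * g x =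
      ∫ x in WithLp.ofLp ⁻¹' (univ.pi fun i => Ico 0 (slabSide n ℓ θ i)),
        g x := by
  rw [← cell_inter_slab hℓ hθ, ← Measure.restrict_restrict (measurableSet_slab ℓ θ),
    ← integral_indicator (measurableSet_slab ℓ θ)]
  refine integral_congr_ae (Eventually.of_forall fun x => ?_)
  simp [slab, indicator_apply]

/-- The slab meets the cell in a box. Testing against a divergence gives the flux through the
boundary of the box; this overestimates the perimeter on the torus, but only finiteness matters. The
mean is the ratio of the volumes of box and cell. -/
lemma slab_mem_admissible (hℓ : 0 < ℓ) {θ : ℝ} (hθ : θ ∈ Icc (0 : ℝ) 1) :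
    slab n ℓ θ ∈ admissible (n + 1) ℓ θ := by
  refine ⟨⟨?_, fun i x => ?_, fun x => ?_, ?_⟩, ?_⟩
  · exact Measurable.ite (measurableSet_slab ℓ θ) measurable_const measurable_const
  · have : Int.fract ((x + EuclideanSpace.single i ℓ) 0 / ℓ) = Int.fract (x 0 / ℓ) := by
      rcases eq_or_ne i 0 with rfl | hi
      · simp [add_div, hℓ.ne']
      · simp [hi.symm]
    simp only [slab, this]
  · unfold slab
    split_ifs <;> simp
  · obtain ⟨C, hC⟩ := exists_integral_divergence_box_le
      (b := slabSide n ℓ θ) (fun i => by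
        refine Fin.cases ?_ (fun i => ?_) i
        · simpa [slabSide] using mul_nonneg hθ.1 hℓ.le
        · simpa [slabSide] using hℓ.le)
    refine lt_of_le_of_lt ?_ (ENNReal.ofReal_lt_top (r := C))
    refine iSup_le fun φ => iSup_le fun hφ => iSup_le fun hp => iSup_le fun hφb => ?_
    rw [setIntegral_cell_slab_mul hℓ hθ.2]
    exact ENNReal.ofReal_le_ofReal (hC φ hφ hφb)
  · have h := setIntegral_cell_slab_mul (n := n) hℓ hθ.2 fun _ => 1
    simp only [mul_one, integral_const, MeasurableSet.univ, measureReal_restrict_apply,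
      univ_inter, smul_eq_mul] at h
    rw [setAverage_eq, h, measureReal_def, measureReal_def, volume_cell,
      (PiLp.volume_preserving_ofLp (Fin (n + 1))).measure_preimage
      (MeasurableSet.univ_pi fun _ => measurableSet_Ico).nullMeasurableSet, Real.volume_pi_Ico]
    simp only [Fin.prod_univ_succ, slabSide, Fin.cons_zero, Fin.cons_succ, sub_zero, Finset.prod_const,
      Finset.card_univ, Fintype.card_fin, ENNReal.toReal_mul, ENNReal.toReal_pow,
      ENNReal.toReal_ofReal hℓ.le, ENNReal.toReal_ofReal (mul_nonneg hθ.1 hℓ.le), smul_eq_mul]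
    field_simp
    ring

end Slab

/-! ### Mean translation differences and the direct method. -/

section DirectMethod

variable {d : ℕ} {ℓ : ℝ}

lemma abs_le_one_of_mem_BVIndicator {u : EuclideanSpace ℝ (Fin d) → ℝ}
    (hu : u ∈ BVIndicator d ℓ) (x : EuclideanSpace ℝ (Fin d)) : |u x| ≤ 1 := by
  rcases hu.2.2.1 x with h | h <;> simp [h]

/-- The mean over the torus of `|u(x+z) - u(x)|`. -/
noncomputable def meanTranslation (ℓ : ℝ) (u : EuclideanSpace ℝ (Fin d) → ℝ)
    (z : EuclideanSpace ℝ (Fin d)) : ℝ≥0∞ :=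
  (∫⁻ x in cell d ℓ, ENNReal.ofReal |u (x + z) - u x|) / volume (cell d ℓ)

lemma abs_translate_sub_le_one {u : EuclideanSpace ℝ (Fin d) → ℝ}
    (hu : u ∈ BVIndicator d ℓ) (x z : EuclideanSpace ℝ (Fin d)) : |u (x + z) - u x| ≤ 1 := by
  rcases hu.2.2.1 x with h | h <;> rcases hu.2.2.1 (x + z) with h' | h' <;> simp [h, h']

lemma meanTranslation_le_one {u : EuclideanSpace ℝ (Fin d) → ℝ}
    (hu : u ∈ BVIndicator d ℓ) (z : EuclideanSpace ℝ (Fin d)) : meanTranslation ℓ u z ≤ 1 := by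
  refine ENNReal.div_le_of_le_mul ?_
  rw [one_mul]
  calc ∫⁻ x in cell d ℓ, ENNReal.ofReal |u (x + z) - u x| ≤ ∫⁻ x in cell d ℓ, 1 :=
        lintegral_mono fun x => ENNReal.ofReal_le_one.2 (abs_translate_sub_le_one hu x z)
    _ = _ := by simp

lemma meanTranslation_ne_top {u : EuclideanSpace ℝ (Fin d) → ℝ}
    (hu : u ∈ BVIndicator d ℓ) (z : EuclideanSpace ℝ (Fin d)) : meanTranslation ℓ u z ≠ ⊤ :=
  ne_top_of_le_ne_top ENNReal.one_ne_top (meanTranslation_le_one hu z)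

lemma measurable_meanTranslation {u : EuclideanSpace ℝ (Fin d) → ℝ} (hu : Measurable u) :
    Measurable (meanTranslation ℓ u) := by
  have hm : Measurable fun p : EuclideanSpace ℝ (Fin d) × EuclideanSpace ℝ (Fin d) =>
      ENNReal.ofReal |u (p.2 + p.1) - u p.2| :=
    ((hu.comp (measurable_snd.add measurable_fst)).sub
      (hu.comp measurable_snd)).abs.ennreal_ofReal
  exact hm.lintegral_prod_right'.div_const _

lemma meanTranslation_le_directionalVariation (hℓ : 0 < ℓ)
    {u : EuclideanSpace ℝ (Fin d) → ℝ} (hu : u ∈ BVIndicator d ℓ)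
    (z : EuclideanSpace ℝ (Fin d)) :
    meanTranslation ℓ u z ≤ ENNReal.ofReal ‖z‖ *
      (directionalVariation ℓ (‖z‖⁻¹ • z) u / volume (cell d ℓ)) := by
  have h := lintegral_translate_sub_le hℓ hu.1 hu.2.1 (abs_le_one_of_mem_BVIndicator hu) z
  have hz : z = ‖z‖ • (‖z‖⁻¹ • z) := by
    rcases eq_or_ne z 0 with rfl | h
    · simp
    · rw [smul_inv_smul₀ (norm_ne_zero_iff.2 h)]
  rw [← mul_div_assoc, ← directionalVariation_smul (norm_nonneg z), ← hz]
  exact ENNReal.div_le_div_right h _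

lemma directionalVariation_unit_le (u : EuclideanSpace ℝ (Fin d) → ℝ)
    (z : EuclideanSpace ℝ (Fin d)) :
    directionalVariation ℓ (‖z‖⁻¹ • z) u ≤ totalVariation ℓ u := by
  refine directionalVariation_le_totalVariation ?_
  rw [norm_smul, norm_inv, norm_norm]
  exact inv_mul_le_one

lemma tendsto_meanTranslation (hℓ : 0 < ℓ) {un : ℕ → EuclideanSpace ℝ (Fin d) → ℝ}
    {u : EuclideanSpace ℝ (Fin d) → ℝ} (hun : ∀ n, un n ∈ BVIndicator d ℓ)
    (h : ∀ᵐ x, Tendsto (fun n => un n x) atTop (𝓝 (u x))) (z : EuclideanSpace ℝ (Fin d)) :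
    Tendsto (fun n => meanTranslation ℓ (un n) z) atTop (𝓝 (meanTranslation ℓ u z)) := by
  refine ENNReal.Tendsto.div_const ?_ (Or.inr (volume_cell_ne_zero hℓ))
  refine tendsto_lintegral_of_dominated_convergence (fun _ => 1)
    (fun n => (((hun n).1.comp (measurable_add_const z)).sub (hun n).1).abs.ennreal_ofReal)
    (fun n => Eventually.of_forall fun x =>
      ENNReal.ofReal_le_one.2 (abs_translate_sub_le_one (hun n) x z)) ?_ ?_
  · simp [volume_cell_ne_top]
  · have hz : ∀ᵐ x, Tendsto (fun n => un n (x + z)) atTop (𝓝 (u (x + z))) :=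
      (measurePreserving_add_right volume z).quasiMeasurePreserving.ae h
    filter_upwards [ae_restrict_of_ae h, ae_restrict_of_ae hz] with x hx hxz
    exact ENNReal.tendsto_ofReal (hxz.sub hx).abs

/-- Superadditivity of the lower limit. No finiteness is needed, because `⊤ + ⊥ = ⊥` in `EReal`
makes the left side least in the indeterminate case. -/
lemma coe_sub_coe_le_of_tendsto {p q : ℕ → ℝ≥0∞} {P Q : ℝ≥0∞} (hP : P ≤ liminf p atTop)
    (hq : Tendsto q atTop (𝓝 Q)) {m : EReal}
    (hm : Tendsto (fun n => (p n : EReal) - (q n : EReal)) atTop (𝓝 m)) :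
    (P : EReal) - (Q : EReal) ≤ m := by
  have h1 : liminf (fun n => (p n : EReal)) atTop = ((liminf p atTop : ℝ≥0∞) : EReal) :=
    (EReal.coe_ennreal_strictMono.monotone.map_liminf_of_continuousAt p
      continuous_coe_ennreal_ereal.continuousAt).symm
  have hq' : Tendsto (fun n => -(q n : EReal)) atTop (𝓝 (-(Q : EReal))) :=
    (continuous_coe_ennreal_ereal.tendsto Q |>.comp hq).neg
  have h2 := hq'.liminf_eq
  have h3 := EReal.le_liminf_add (f := atTop) (u := fun n => (p n : EReal))
    (v := fun n => -(q n : EReal))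
  rw [← hm.liminf_eq]
  refine le_trans ?_ h3
  rw [h1, h2, sub_eq_add_neg]
  gcongr
  exact_mod_cast hP

/-- The direct method: a coercive, sequentially lower semicontinuous functional on
`BV(𝕋_ℓ; {0,1})` has a minimizer under a volume constraint. -/
lemma exists_isMinOn_admissible (hℓ : 0 < ℓ) {θ : ℝ} (hne : (admissible d ℓ θ).Nonempty)
    {E : (EuclideanSpace ℝ (Fin d) → ℝ) → EReal}
    (hcoercive : ∀ C : ℝ, ∃ B : ℝ≥0∞, B ≠ ⊤ ∧ ∀ u ∈ BVIndicator d ℓ, E u ≤ C →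
      totalVariation ℓ u ≤ B)
    (hlsc : ∀ (un : ℕ → EuclideanSpace ℝ (Fin d) → ℝ) (u : EuclideanSpace ℝ (Fin d) → ℝ)
      (B : ℝ≥0∞) (m : EReal), (∀ n, un n ∈ BVIndicator d ℓ) → u ∈ BVIndicator d ℓ → B ≠ ⊤ →
      (∀ n, totalVariation ℓ (un n) ≤ B) →
      (∀ᵐ x, Tendsto (fun n => un n x) atTop (𝓝 (u x))) →
      Tendsto (fun n => E (un n)) atTop (𝓝 m) → E u ≤ m) :
    ∃ u ∈ admissible d ℓ θ, IsMinOn E (admissible d ℓ θ) u := by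
  set m := sInf (E '' admissible d ℓ θ) with hm
  have hle : ∀ u ∈ admissible d ℓ θ, m ≤ E u := fun u hu => sInf_le (mem_image_of_mem E hu)
  -- An energy identically `⊤` on the class is minimized by any of its elements; otherwise a
  -- minimizing sequence eventually lies below a real level, where coercivity applies.
  rcases eq_or_ne m ⊤ with htop | htop
  · obtain ⟨u, hu⟩ := hne
    refine ⟨u, hu, fun v hv => ?_⟩
    have := hle v hv
    rw [htop, top_le_iff] at this
    simp [this]
  obtain ⟨e, -, he, hmem⟩ := exists_seq_tendsto_sInf (hne.image E) (OrderBot.bddBelow _)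
  choose un hun hEun using hmem
  obtain ⟨C, hmC, -⟩ := EReal.exists_between_coe_real (lt_top_iff_ne_top.2 htop)
  obtain ⟨B, hB, hbound⟩ := hcoercive C
  obtain ⟨N, hN⟩ := eventually_atTop.1 (he.eventually_lt_const hmC)
  have hTV : ∀ n, totalVariation ℓ (un (n + N)) ≤ B := fun n =>
    hbound _ (hun _).1 (by rw [hEun]; exact (hN _ (Nat.le_add_left _ _)).le)
  obtain ⟨ψ, hψ, u, hu, hconv⟩ := exists_subseq_ae_tendsto_indicator hℓ
    (fun n => (hun (n + N)).1) hB hTV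
  have hmean : ⨍ x in cell d ℓ, u x = θ := by
    have h1 := tendsto_integral_cell_mul (ℓ := ℓ) (fun n => (hun (ψ n + N)).1.1)
      (fun n => abs_le_one_of_mem_BVIndicator (hun (ψ n + N)).1) hconv
      (integrableOn_cell (continuous_const (y := (1 : ℝ))))
    simp only [mul_one] at h1
    have h2 := h1.const_smul (volume.real (cell d ℓ))⁻¹
    simp only [← setAverage_eq, (hun _).2] at h2
    exact tendsto_nhds_unique h2 tendsto_const_nhds
  refine ⟨u, ⟨hu, hmean⟩, fun v hv => ?_⟩
  refine le_trans ?_ (hle v hv)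
  refine hlsc (fun n => un (ψ n + N)) u B m (fun n => (hun _).1) hu hB (fun n => hTV _) hconv ?_
  simp only [hEun]
  exact he.comp ((tendsto_add_atTop_nat N).comp hψ.tendsto_atTop)

end DirectMethod

/-! ### Coercivity and lower semicontinuity for an integrable kernel. -/

section ApproxEnergy

variable {d : ℕ} {ℓ : ℝ} {κ : ℝ → ℝ≥0}

/-- The nonlocal part of the energy with an integrable kernel. -/
noncomputable def nonlocalPart (ℓ : ℝ) (κ : ℝ → ℝ≥0) (u : EuclideanSpace ℝ (Fin d) → ℝ) :
    ℝ≥0∞ :=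
  ∫⁻ z : EuclideanSpace ℝ (Fin d),
    κ ‖z‖ * (ENNReal.ofReal (2 * ‖z‖)⁻¹ * meanTranslation ℓ u z)

lemma approxEnergy_eq {u : EuclideanSpace ℝ (Fin d) → ℝ} :
    approxEnergy ℓ κ u =
      ((kernelMass d κ * (totalVariation ℓ u / volume (cell d ℓ)) : ℝ≥0∞) : EReal) -
        (nonlocalPart ℓ κ u : EReal) := by
  have : ∀ z, (∫⁻ x in cell d ℓ, ENNReal.ofReal (|u (x + z) - u x| / (2 * ‖z‖))) /
      volume (cell d ℓ) = ENNReal.ofReal (2 * ‖z‖)⁻¹ * meanTranslation ℓ u z := by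
    intro z
    have h0 : 0 ≤ (2 * ‖z‖)⁻¹ := by positivity
    simp only [div_eq_inv_mul _ (2 * ‖z‖), ENNReal.ofReal_mul h0]
    rw [lintegral_const_mul' _ _ ENNReal.ofReal_ne_top, meanTranslation, mul_div_assoc]
  simp only [approxEnergy, this, nonlocalPart]

lemma mul_meanTranslation_le_totalVariation (hℓ : 0 < ℓ) {u : EuclideanSpace ℝ (Fin d) → ℝ}
    (hu : u ∈ BVIndicator d ℓ) (z : EuclideanSpace ℝ (Fin d)) :
    ENNReal.ofReal (2 * ‖z‖)⁻¹ * meanTranslation ℓ u z ≤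
      2⁻¹ * (totalVariation ℓ u / volume (cell d ℓ)) := by
  calc ENNReal.ofReal (2 * ‖z‖)⁻¹ * meanTranslation ℓ u z
      ≤ ENNReal.ofReal (2 * ‖z‖)⁻¹ * (ENNReal.ofReal ‖z‖ *
        (totalVariation ℓ u / volume (cell d ℓ))) := by
        gcongr
        refine (meanTranslation_le_directionalVariation hℓ hu z).trans ?_
        gcongr
        exact directionalVariation_unit_le u z
    _ = ENNReal.ofReal ((2 * ‖z‖)⁻¹ * ‖z‖) * (totalVariation ℓ u / volume (cell d ℓ)) := by
        rw [ENNReal.ofReal_mul (by positivity), mul_assoc]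
    _ ≤ ENNReal.ofReal 2⁻¹ * (totalVariation ℓ u / volume (cell d ℓ)) := by
        gcongr
        rw [mul_inv, mul_assoc]
        exact mul_le_of_le_one_right (by norm_num) inv_mul_le_one
    _ = _ := by rw [ENNReal.ofReal_inv_of_pos two_pos, ENNReal.ofReal_ofNat]

lemma mul_meanTranslation_le_inv {u : EuclideanSpace ℝ (Fin d) → ℝ}
    (hu : u ∈ BVIndicator d ℓ) (z : EuclideanSpace ℝ (Fin d)) :
    ENNReal.ofReal (2 * ‖z‖)⁻¹ * meanTranslation ℓ u z ≤ ENNReal.ofReal ‖z‖⁻¹ := by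
  refine (mul_le_of_le_one_right zero_le (meanTranslation_le_one hu z)).trans ?_
  refine ENNReal.ofReal_le_ofReal ?_
  rw [mul_inv]
  exact mul_le_of_le_one_left (by positivity) (by norm_num)

lemma measurable_kernel_norm (hκ : Measurable κ) :
    Measurable fun z : EuclideanSpace ℝ (Fin d) => (κ ‖z‖ : ℝ≥0∞) :=
  (hκ.comp measurable_norm).coe_nnreal_ennreal

/-- Near the origin the translation estimate cancels `|z|` and leaves `1/2` of the perimeter; far
away the mean difference is at most one and the tail of the kernel remains. -/
lemma nonlocalPart_le (hℓ : 0 < ℓ) {u : EuclideanSpace ℝ (Fin d) → ℝ}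
    (hu : u ∈ BVIndicator d ℓ) (δ : ℝ) :
    nonlocalPart ℓ κ u ≤
      (∫⁻ z in Metric.closedBall (0 : EuclideanSpace ℝ (Fin d)) δ, (κ ‖z‖ : ℝ≥0∞)) *
        (2⁻¹ * (totalVariation ℓ u / volume (cell d ℓ))) +
      ∫⁻ z in (Metric.closedBall (0 : EuclideanSpace ℝ (Fin d)) δ)ᶜ,
        (κ ‖z‖ : ℝ≥0∞) * ENNReal.ofReal ‖z‖⁻¹ := by
  rw [nonlocalPart, ← lintegral_add_compl _
    (measurableSet_closedBall (x := (0 : EuclideanSpace ℝ (Fin d))) (ε := δ))]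
  refine add_le_add ?_ ?_
  · by_cases hV : 2⁻¹ * (totalVariation ℓ u / volume (cell d ℓ)) = ⊤
    · exact absurd hV (ENNReal.mul_ne_top (by simp)
        (ENNReal.div_ne_top hu.2.2.2.ne (volume_cell_ne_zero hℓ)))
    rw [← lintegral_mul_const' _ _ hV]
    exact lintegral_mono fun z =>
      mul_le_mul_right (mul_meanTranslation_le_totalVariation hℓ hu z) _
  · refine lintegral_mono fun z => ?_
    gcongr
    exact mul_meanTranslation_le_inv hu z

/-- Absolute continuity of the integral, as the balls shrink to a null set. -/
lemma exists_closedBall_kernel_le (hd : 1 ≤ d)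
    (hI : ∫⁻ z in Metric.ball (0 : EuclideanSpace ℝ (Fin d)) 1, (κ ‖z‖ : ℝ≥0∞) ≠ ⊤)
    {a : ℝ≥0∞} (ha : a ≠ 0) :
    ∃ δ : ℝ, 0 < δ ∧ δ < 1 ∧
      ∫⁻ z in Metric.closedBall (0 : EuclideanSpace ℝ (Fin d)) δ, (κ ‖z‖ : ℝ≥0∞) ≤ a := by
  have hball : Tendsto (fun δ : ℝ => (volume.restrict (Metric.ball 0 1))
      (Metric.closedBall (0 : EuclideanSpace ℝ (Fin d)) δ)) (𝓝[>] 0) (𝓝 0) := by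
    have h1 : Tendsto (fun δ : ℝ => ENNReal.ofReal (δ ^ d) *
        volume (Metric.ball (0 : EuclideanSpace ℝ (Fin d)) 1)) (𝓝[>] 0) (𝓝 0) := by
      have h2 : Tendsto (fun δ : ℝ => ENNReal.ofReal (δ ^ d)) (𝓝 0) (𝓝 0) := by
        have := (ENNReal.continuous_ofReal.comp (continuous_pow (M := ℝ) d)).tendsto 0
        simpa [zero_pow (by omega : d ≠ 0), Function.comp_def] using this
      have := ENNReal.Tendsto.mul_const h2 (Or.inr (measure_ball_lt_top
        (μ := volume) (x := (0 : EuclideanSpace ℝ (Fin d))) (r := 1)).ne)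
      rw [zero_mul] at this
      exact this.mono_left nhdsWithin_le_nhds
    refine tendsto_of_tendsto_of_tendsto_of_le_of_le' tendsto_const_nhds h1
      (Eventually.of_forall fun _ => zero_le) ?_
    filter_upwards [self_mem_nhdsWithin] with δ hδ
    refine (Measure.restrict_apply_le _ _).trans (le_of_eq ?_)
    rw [Measure.addHaar_closedBall _ _ (le_of_lt hδ), finrank_euclideanSpace_fin]
  have hlim := tendsto_setLIntegral_zero hI hball
  obtain ⟨δ, h1, h2⟩ := ((hlim.eventually_lt_const ha.bot_lt).and
    (Ioo_mem_nhdsGT (zero_lt_one (α := ℝ)))).exists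
  refine ⟨δ, h2.1, h2.2, le_trans (le_of_eq ?_) h1.le⟩
  rw [Measure.restrict_restrict measurableSet_closedBall, inter_eq_self_of_subset_left
    (Metric.closedBall_subset_ball h2.2)]

/-- Let `t` be the perimeter per volume and `M` the kernel mass. Choosing `δ` so that `κ` has mass
at most `M` in the ball of radius `δ`, the nonlocal part is at most `M t / 2 + T`, with `T` the tail
beyond `δ`. An energy at most `C` then forces `t ≤ 2 (C + T) / M`. -/
lemma approxEnergy_coercive (hd : 1 ≤ d) (hℓ : 0 < ℓ) (htail : HasTail d κ)
    (hI : ∫⁻ z in Metric.ball (0 : EuclideanSpace ℝ (Fin d)) 1, (κ ‖z‖ : ℝ≥0∞) ≠ ⊤)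
    (hM0 : kernelMass d κ ≠ 0) (hMt : kernelMass d κ ≠ ⊤) (C : ℝ) :
    ∃ B : ℝ≥0∞, B ≠ ⊤ ∧ ∀ u ∈ BVIndicator d ℓ, approxEnergy ℓ κ u ≤ C →
      totalVariation ℓ u ≤ B := by
  obtain ⟨δ, hδ, -, hδM⟩ := exists_closedBall_kernel_le hd hI hM0
  have hT := (htail δ hδ).ne
  set T := ∫⁻ z in (Metric.closedBall (0 : EuclideanSpace ℝ (Fin d)) δ)ᶜ,
    (κ ‖z‖ : ℝ≥0∞) * ENNReal.ofReal ‖z‖⁻¹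
  set M := kernelMass d κ
  refine ⟨ENNReal.ofReal (2 * (C + T.toReal) / M.toReal) * volume (cell d ℓ),
    ENNReal.mul_ne_top ENNReal.ofReal_ne_top volume_cell_ne_top, fun u hu hE => ?_⟩
  have ht : totalVariation ℓ u / volume (cell d ℓ) ≠ ⊤ :=
    ENNReal.div_ne_top hu.2.2.2.ne (volume_cell_ne_zero hℓ)
  have hQ : nonlocalPart ℓ κ u ≤ M * (2⁻¹ * (totalVariation ℓ u / volume (cell d ℓ))) + T :=
    (nonlocalPart_le hℓ hu δ).trans (by gcongr)
  rw [approxEnergy_eq] at hE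
  rw [← ENNReal.div_le_iff (volume_cell_ne_zero hℓ) volume_cell_ne_top]
  set t := totalVariation ℓ u / volume (cell d ℓ)
  have hbt : M * (2⁻¹ * t) + T ≠ ⊤ :=
    ENNReal.add_ne_top.2 ⟨ENNReal.mul_ne_top hMt (ENNReal.mul_ne_top (by simp) ht), hT⟩
  have hQt : nonlocalPart ℓ κ u ≠ ⊤ := ne_top_of_le_ne_top hbt hQ
  have hQ' := ENNReal.toReal_mono hbt hQ
  rw [ENNReal.toReal_add (ENNReal.mul_ne_top hMt (ENNReal.mul_ne_top (by simp) ht)) hT,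
    ENNReal.toReal_mul, ENNReal.toReal_mul, ENNReal.toReal_inv, ENNReal.toReal_ofNat] at hQ'
  have hE' : M.toReal * t.toReal - (nonlocalPart ℓ κ u).toReal ≤ C := by
    rw [← EReal.coe_ennreal_toReal (ENNReal.mul_ne_top hMt ht),
      ← EReal.coe_ennreal_toReal hQt, ENNReal.toReal_mul, ← EReal.coe_sub,
      EReal.coe_le_coe_iff] at hE
    exact hE
  have hMpos : 0 < M.toReal := ENNReal.toReal_pos hM0 hMt
  rw [← ENNReal.ofReal_toReal ht]
  refine ENNReal.ofReal_le_ofReal ?_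
  rw [le_div_iff₀ hMpos]
  nlinarith

lemma tendsto_nonlocalPart (hℓ : 0 < ℓ) (hκ : Measurable κ) (htail : HasTail d κ)
    (hI : ∫⁻ z in Metric.ball (0 : EuclideanSpace ℝ (Fin d)) 1, (κ ‖z‖ : ℝ≥0∞) ≠ ⊤)
    {un : ℕ → EuclideanSpace ℝ (Fin d) → ℝ} {u : EuclideanSpace ℝ (Fin d) → ℝ} {B : ℝ≥0∞}
    (hun : ∀ n, un n ∈ BVIndicator d ℓ) (hB : B ≠ ⊤) (hTV : ∀ n, totalVariation ℓ (un n) ≤ B)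
    (h : ∀ᵐ x, Tendsto (fun n => un n x) atTop (𝓝 (u x))) :
    Tendsto (fun n => nonlocalPart ℓ κ (un n)) atTop (𝓝 (nonlocalPart ℓ κ u)) := by
  have hinv : Measurable fun z : EuclideanSpace ℝ (Fin d) => ENNReal.ofReal (2 * ‖z‖)⁻¹ :=
    (measurable_norm.const_mul 2).inv.ennreal_ofReal
  -- The two regions of the majorant overlap: `HasTail` controls complements of closed balls, so a
  -- radius below one is needed to reach the sphere `|z| = 1`.
  refine tendsto_lintegral_of_dominated_convergence (fun z =>
    (Metric.ball (0 : EuclideanSpace ℝ (Fin d)) 1).indicator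
      (fun z => (κ ‖z‖ : ℝ≥0∞) * (2⁻¹ * (B / volume (cell d ℓ)))) z +
    (Metric.closedBall (0 : EuclideanSpace ℝ (Fin d)) (1 / 2))ᶜ.indicator
      (fun z => (κ ‖z‖ : ℝ≥0∞) * ENNReal.ofReal ‖z‖⁻¹) z)
    (fun n => (measurable_kernel_norm hκ).mul (hinv.mul (measurable_meanTranslation (hun n).1)))
    (fun n => Eventually.of_forall fun z => ?_) ?_ (Eventually.of_forall fun z => ?_)
  · by_cases hz : z ∈ Metric.ball (0 : EuclideanSpace ℝ (Fin d)) 1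
    · refine le_add_right ?_
      rw [indicator_of_mem hz]
      refine mul_le_mul_right ((mul_meanTranslation_le_totalVariation hℓ (hun n) z).trans ?_) _
      gcongr
      exact hTV n
    · refine le_add_left ?_
      rw [indicator_of_mem (by
        simp only [Metric.mem_ball, dist_zero_right, not_lt] at hz
        simp only [mem_compl_iff, Metric.mem_closedBall, dist_zero_right, not_le]
        linarith)]
      exact mul_le_mul_right (mul_meanTranslation_le_inv (hun n) z) _
  · have hfin : 2⁻¹ * (B / volume (cell d ℓ)) ≠ ⊤ :=
      ENNReal.mul_ne_top (by simp) (ENNReal.div_ne_top hB (volume_cell_ne_zero hℓ))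
    rw [lintegral_add_left (((measurable_kernel_norm hκ).mul_const _).indicator
      measurableSet_ball), lintegral_indicator measurableSet_ball,
      lintegral_indicator measurableSet_closedBall.compl, lintegral_mul_const' _ _ hfin]
    exact ENNReal.add_ne_top.2 ⟨ENNReal.mul_ne_top hI hfin, (htail _ (by norm_num)).ne⟩
  · refine ENNReal.Tendsto.const_mul (ENNReal.Tendsto.const_mul
      (tendsto_meanTranslation hℓ hun h z) (Or.inr ENNReal.ofReal_ne_top))
      (Or.inr ENNReal.coe_ne_top)

lemma approxEnergy_le_of_tendsto (hℓ : 0 < ℓ) (hκ : Measurable κ) (htail : HasTail d κ)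
    (hI : ∫⁻ z in Metric.ball (0 : EuclideanSpace ℝ (Fin d)) 1, (κ ‖z‖ : ℝ≥0∞) ≠ ⊤)
    (hMt : kernelMass d κ ≠ ⊤)
    {un : ℕ → EuclideanSpace ℝ (Fin d) → ℝ} {u : EuclideanSpace ℝ (Fin d) → ℝ} {B : ℝ≥0∞}
    {m : EReal} (hun : ∀ n, un n ∈ BVIndicator d ℓ) (hB : B ≠ ⊤)
    (hTV : ∀ n, totalVariation ℓ (un n) ≤ B)
    (h : ∀ᵐ x, Tendsto (fun n => un n x) atTop (𝓝 (u x)))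
    (hm : Tendsto (fun n => approxEnergy ℓ κ (un n)) atTop (𝓝 m)) :
    approxEnergy ℓ κ u ≤ m := by
  simp only [approxEnergy_eq] at hm ⊢
  refine coe_sub_coe_le_of_tendsto ?_ (tendsto_nonlocalPart hℓ hκ htail hI hun hB hTV h) hm
  have hmono : Monotone fun t : ℝ≥0∞ => kernelMass d κ * (t / volume (cell d ℓ)) :=
    fun s t hst => mul_le_mul_right (ENNReal.div_le_div_right hst _) _
  have hcont : Continuous fun t : ℝ≥0∞ => kernelMass d κ * (t / volume (cell d ℓ)) :=
    (ENNReal.continuous_const_mul hMt).comp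
      (ENNReal.continuous_div_const _ (volume_cell_ne_zero hℓ))
  have := hmono.map_liminf_of_continuousAt (F := atTop) (fun n => totalVariation ℓ (un n))
    hcont.continuousAt
  refine le_trans ?_ this.le
  exact hmono (totalVariation_le_liminf (fun n => (hun n).1)
    (fun n => abs_le_one_of_mem_BVIndicator (hun n)) h)

end ApproxEnergy

/-! ### Coercivity and lower semicontinuity of the limit energy. -/

section LimitEnergy

variable {d : ℕ} {ℓ : ℝ} {κ : ℝ → ℝ≥0}

/-- The integrand of the limit energy. -/
noncomputable def limitDensity (ℓ : ℝ) (κ : ℝ → ℝ≥0) (u : EuclideanSpace ℝ (Fin d) → ℝ)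
    (z : EuclideanSpace ℝ (Fin d)) : ℝ :=
  (1 / 2) * ((κ ‖z‖ : ℝ) *
    ((Metric.ball (0 : EuclideanSpace ℝ (Fin d)) 1).indicator
        (fun z => (directionalVariation ℓ (‖z‖⁻¹ • z) u / volume (cell d ℓ)).toReal) z
      - (meanTranslation ℓ u z).toReal / ‖z‖))

lemma limitEnergy_eq {u : EuclideanSpace ℝ (Fin d) → ℝ} (hu : u ∈ BVIndicator d ℓ) :
    limitEnergy ℓ κ u = extIntegral (limitDensity ℓ κ u) := by
  have : ∀ z, ⨍ x in cell d ℓ, |u (x + z) - u x| / ‖z‖ =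
      (meanTranslation ℓ u z).toReal / ‖z‖ := by
    intro z
    have hm : Measurable fun x => |u (x + z) - u x| :=
      ((hu.1.comp (measurable_add_const z)).sub hu.1).abs
    rw [setAverage_eq, integral_div, integral_eq_lintegral_of_nonneg_ae
      (Eventually.of_forall fun x => abs_nonneg _) hm.aestronglyMeasurable, meanTranslation,
      ENNReal.toReal_div, smul_eq_mul, measureReal_def]
    ring
  simp only [limitEnergy, this]
  rfl

lemma directionalVariation_unit_div_ne_top (hℓ : 0 < ℓ) {u : EuclideanSpace ℝ (Fin d) → ℝ}
    (hu : u ∈ BVIndicator d ℓ) (z : EuclideanSpace ℝ (Fin d)) :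
    directionalVariation ℓ (‖z‖⁻¹ • z) u / volume (cell d ℓ) ≠ ⊤ :=
  ENNReal.div_ne_top (ne_top_of_le_ne_top hu.2.2.2.ne (directionalVariation_unit_le u z))
    (volume_cell_ne_zero hℓ)

/-- This is the translation estimate divided by `|z|`. Hence the negative part of the integrand
lives outside the unit ball, where the tail condition makes it integrable even for a kernel singular
at the origin. -/
lemma limitDensity_nonneg (hℓ : 0 < ℓ) {u : EuclideanSpace ℝ (Fin d) → ℝ}
    (hu : u ∈ BVIndicator d ℓ) {z : EuclideanSpace ℝ (Fin d)} (hz : z ∈ Metric.ball 0 1) :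
    0 ≤ limitDensity ℓ κ u z := by
  have h := ENNReal.toReal_mono (ENNReal.mul_ne_top ENNReal.ofReal_ne_top
    (directionalVariation_unit_div_ne_top hℓ hu z))
    (meanTranslation_le_directionalVariation hℓ hu z)
  rw [ENNReal.toReal_mul, ENNReal.toReal_ofReal (norm_nonneg z)] at h
  rw [limitDensity, indicator_of_mem hz]
  have h2 : (meanTranslation ℓ u z).toReal / ‖z‖ ≤
      (directionalVariation ℓ (‖z‖⁻¹ • z) u / volume (cell d ℓ)).toReal := by
    refine div_le_of_le_mul₀ (norm_nonneg z) ENNReal.toReal_nonneg ?_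
    rwa [mul_comm]
  have := sub_nonneg.2 h2
  positivity

lemma limitDensity_of_notMem {u : EuclideanSpace ℝ (Fin d) → ℝ}
    {z : EuclideanSpace ℝ (Fin d)} (hz : z ∉ Metric.ball 0 1) :
    limitDensity ℓ κ u z = -(κ ‖z‖ * ((2 * ‖z‖)⁻¹ * (meanTranslation ℓ u z).toReal)) := by
  rw [limitDensity, indicator_of_notMem hz, mul_inv]
  ring

lemma ofReal_kernel_mul {u : EuclideanSpace ℝ (Fin d) → ℝ} (hu : u ∈ BVIndicator d ℓ)
    (z : EuclideanSpace ℝ (Fin d)) :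
    ENNReal.ofReal (κ ‖z‖ * ((2 * ‖z‖)⁻¹ * (meanTranslation ℓ u z).toReal)) =
      κ ‖z‖ * (ENNReal.ofReal (2 * ‖z‖)⁻¹ * meanTranslation ℓ u z) := by
  rw [ENNReal.ofReal_mul NNReal.zero_le_coe, ENNReal.ofReal_mul (by positivity),
    ENNReal.ofReal_toReal (meanTranslation_ne_top hu z), ENNReal.ofReal_coe_nnreal]

lemma ofReal_neg_limitDensity (hℓ : 0 < ℓ) {u : EuclideanSpace ℝ (Fin d) → ℝ}
    (hu : u ∈ BVIndicator d ℓ) (z : EuclideanSpace ℝ (Fin d)) :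
    ENNReal.ofReal (-limitDensity ℓ κ u z) = (Metric.ball 0 1)ᶜ.indicator
      (fun z => κ ‖z‖ * (ENNReal.ofReal (2 * ‖z‖)⁻¹ * meanTranslation ℓ u z)) z := by
  by_cases hz : z ∈ Metric.ball (0 : EuclideanSpace ℝ (Fin d)) 1
  · rw [indicator_of_notMem (by simpa using hz),
      ENNReal.ofReal_eq_zero.2 (neg_nonpos.2 (limitDensity_nonneg hℓ hu hz))]
  · rw [indicator_of_mem (show z ∈ (Metric.ball 0 1)ᶜ from hz), limitDensity_of_notMem hz,
      neg_neg, ofReal_kernel_mul hu]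

lemma ofReal_neg_limitDensity_le (hℓ : 0 < ℓ) {u : EuclideanSpace ℝ (Fin d) → ℝ}
    (hu : u ∈ BVIndicator d ℓ) (z : EuclideanSpace ℝ (Fin d)) :
    ENNReal.ofReal (-limitDensity ℓ κ u z) ≤
      (Metric.closedBall (0 : EuclideanSpace ℝ (Fin d)) (1 / 2))ᶜ.indicator
        (fun z => (κ ‖z‖ : ℝ≥0∞) * ENNReal.ofReal ‖z‖⁻¹) z := by
  rw [ofReal_neg_limitDensity hℓ hu]
  by_cases hz : z ∈ Metric.ball (0 : EuclideanSpace ℝ (Fin d)) 1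
  · rw [indicator_of_notMem (by simpa using hz)]
    exact zero_le
  · rw [indicator_of_mem (show z ∈ (Metric.ball 0 1)ᶜ from hz), indicator_of_mem (by
        simp only [Metric.mem_ball, dist_zero_right, not_lt] at hz
        simp only [mem_compl_iff, Metric.mem_closedBall, dist_zero_right, not_le]
        linarith)]
    exact mul_le_mul_right (mul_meanTranslation_le_inv hu z) _

lemma measurable_directionalVariation_unit {u : EuclideanSpace ℝ (Fin d) → ℝ}
    (hu : u ∈ BVIndicator d ℓ) :
    Measurable fun z => directionalVariation ℓ (‖z‖⁻¹ • z) u :=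
  (lowerSemicontinuous_directionalVariation hu.1
    (abs_le_one_of_mem_BVIndicator hu)).measurable.comp
    (measurable_norm.inv.smul measurable_id)

lemma measurable_limitDensity (hκ : Measurable κ) {u : EuclideanSpace ℝ (Fin d) → ℝ}
    (hu : u ∈ BVIndicator d ℓ) : Measurable (limitDensity ℓ κ u) := by
  refine ((hκ.comp measurable_norm).coe_nnreal_real.mul (Measurable.sub ?_ ?_)).const_mul _
  · exact ((measurable_directionalVariation_unit hu).div_const _).ennreal_toReal.indicator
      measurableSet_ball
  · exact (measurable_meanTranslation hu.1).ennreal_toReal.div measurable_norm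

lemma tendsto_lintegral_neg_limitDensity (hℓ : 0 < ℓ) (hκ : Measurable κ) (htail : HasTail d κ)
    {un : ℕ → EuclideanSpace ℝ (Fin d) → ℝ} {u : EuclideanSpace ℝ (Fin d) → ℝ}
    (hun : ∀ n, un n ∈ BVIndicator d ℓ) (hu : u ∈ BVIndicator d ℓ)
    (h : ∀ᵐ x, Tendsto (fun n => un n x) atTop (𝓝 (u x))) :
    Tendsto (fun n => ∫⁻ z, ENNReal.ofReal (-limitDensity ℓ κ (un n) z)) atTop
      (𝓝 (∫⁻ z, ENNReal.ofReal (-limitDensity ℓ κ u z))) := by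
  refine tendsto_lintegral_of_dominated_convergence _
    (fun n => (measurable_limitDensity hκ (hun n)).neg.ennreal_ofReal)
    (fun n => Eventually.of_forall fun z => ofReal_neg_limitDensity_le hℓ (hun n) z) ?_
    (Eventually.of_forall fun z => ?_)
  · rw [lintegral_indicator measurableSet_closedBall.compl]
    exact (htail _ (by norm_num)).ne
  · simp only [ofReal_neg_limitDensity hℓ (hun _), ofReal_neg_limitDensity hℓ hu]
    by_cases hz : z ∈ Metric.ball (0 : EuclideanSpace ℝ (Fin d)) 1
    · have hz' : z ∉ (Metric.ball (0 : EuclideanSpace ℝ (Fin d)) 1)ᶜ := by simpa using hz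
      simp only [indicator_of_notMem hz']
      exact tendsto_const_nhds
    · simp only [indicator_of_mem (show z ∈ (Metric.ball 0 1)ᶜ from hz)]
      exact ENNReal.Tendsto.const_mul (ENNReal.Tendsto.const_mul
        (tendsto_meanTranslation hℓ hun h z) (Or.inr ENNReal.ofReal_ne_top))
        (Or.inr ENNReal.coe_ne_top)

lemma ofReal_limitDensity_le_liminf (hℓ : 0 < ℓ)
    {un : ℕ → EuclideanSpace ℝ (Fin d) → ℝ} {u : EuclideanSpace ℝ (Fin d) → ℝ}
    (hun : ∀ n, un n ∈ BVIndicator d ℓ) (hu : u ∈ BVIndicator d ℓ)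
    (h : ∀ᵐ x, Tendsto (fun n => un n x) atTop (𝓝 (u x))) (z : EuclideanSpace ℝ (Fin d)) :
    ENNReal.ofReal (limitDensity ℓ κ u z) ≤
      liminf (fun n => ENNReal.ofReal (limitDensity ℓ κ (un n) z)) atTop := by
  by_cases hz : z ∈ Metric.ball (0 : EuclideanSpace ℝ (Fin d)) 1
  swap
  · rw [ENNReal.ofReal_eq_zero.2]
    · exact zero_le
    · rw [limitDensity_of_notMem hz]
      exact neg_nonpos.2 (by positivity)
  set N := fun v => directionalVariation ℓ (‖z‖⁻¹ • z) v / volume (cell d ℓ) with hN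
  have hNle : N u ≤ liminf (fun n => N (un n)) atTop := by
    have hmono : Monotone fun t : ℝ≥0∞ => t / volume (cell d ℓ) :=
      fun s t hst => ENNReal.div_le_div_right hst _
    have := hmono.map_liminf_of_continuousAt (F := atTop)
      (fun n => directionalVariation ℓ (‖z‖⁻¹ • z) (un n))
      (ENNReal.continuous_div_const _ (volume_cell_ne_zero hℓ)).continuousAt
    refine le_trans ?_ this.le
    exact hmono (directionalVariation_le_liminf (fun n => (hun n).1)
      (fun n => abs_le_one_of_mem_BVIndicator (hun n)) h _)
  have hNt : N u ≠ ⊤ := directionalVariation_unit_div_ne_top hℓ hu z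
  -- Truncating at `N u` turns the lower bound on the lower limit into convergence to a finite
  -- value, so real arithmetic passes to the limit. Undoing the truncation only increases the
  -- density.
  have hmin : Tendsto (fun n => min (N (un n)) (N u)) atTop (𝓝 (N u)) := by
    refine tendsto_order.2 ⟨fun a ha => ?_, fun a ha => ?_⟩
    · exact (eventually_lt_of_lt_liminf (ha.trans_le hNle)).mono fun n hn => lt_min hn ha
    · exact Eventually.of_forall fun n => (min_le_right _ _).trans_lt ha
  have hW := (ENNReal.tendsto_toReal (meanTranslation_ne_top hu z)).comp
    (tendsto_meanTranslation hℓ hun h z)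
  have hlim := ENNReal.tendsto_ofReal (((((ENNReal.tendsto_toReal hNt).comp hmin).sub
    (hW.div_const ‖z‖)).const_mul (κ ‖z‖ : ℝ)).const_mul (1 / 2))
  have heq : ENNReal.ofReal (limitDensity ℓ κ u z) = ENNReal.ofReal ((1 / 2) * ((κ ‖z‖ : ℝ) *
      ((N u).toReal - (meanTranslation ℓ u z).toReal / ‖z‖))) := by
    rw [limitDensity, indicator_of_mem hz]
  rw [heq, ← hlim.liminf_eq]
  refine liminf_le_liminf (Eventually.of_forall fun n => ENNReal.ofReal_le_ofReal ?_)
  rw [limitDensity, indicator_of_mem hz]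
  simp only [Function.comp_apply]
  gcongr
  · exact directionalVariation_unit_div_ne_top hℓ (hun n) z
  · exact min_le_left _ _

/-- Fatou's lemma for the positive part, dominated convergence for the negative part. -/
lemma limitEnergy_le_of_tendsto (hℓ : 0 < ℓ) (hκ : Measurable κ) (htail : HasTail d κ)
    {un : ℕ → EuclideanSpace ℝ (Fin d) → ℝ} {u : EuclideanSpace ℝ (Fin d) → ℝ} {m : EReal}
    (hun : ∀ n, un n ∈ BVIndicator d ℓ) (hu : u ∈ BVIndicator d ℓ)
    (h : ∀ᵐ x, Tendsto (fun n => un n x) atTop (𝓝 (u x)))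
    (hm : Tendsto (fun n => limitEnergy ℓ κ (un n)) atTop (𝓝 m)) :
    limitEnergy ℓ κ u ≤ m := by
  simp only [limitEnergy_eq (hun _), limitEnergy_eq hu, extIntegral] at hm ⊢
  refine coe_sub_coe_le_of_tendsto ?_
    (tendsto_lintegral_neg_limitDensity hℓ hκ htail hun hu h) hm
  exact (lintegral_mono fun z => ofReal_limitDensity_le_liminf hℓ hun hu h z).trans
    (lintegral_liminf_le fun n => (measurable_limitDensity hκ (hun n)).ennreal_ofReal)

lemma directionalVariation_smul_abs (c : ℝ) (w : EuclideanSpace ℝ (Fin d))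
    (u : EuclideanSpace ℝ (Fin d) → ℝ) :
    directionalVariation ℓ (c • w) u = ENNReal.ofReal |c| * directionalVariation ℓ w u := by
  rw [← directionalVariation_smul (abs_nonneg c)]
  rcases abs_cases c with ⟨h, -⟩ | ⟨h, -⟩
  · rw [h]
  · rw [h, neg_smul, directionalVariation_neg]

/-- The reflection that fixes the `i`-th coordinate axis. -/
noncomputable def axisReflection (i : Fin d) :
    EuclideanSpace ℝ (Fin d) ≃ₗᵢ[ℝ] EuclideanSpace ℝ (Fin d) :=
  (ℝ ∙ (EuclideanSpace.single i (1 : ℝ))).reflection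

lemma add_axisReflection (i : Fin d) (z : EuclideanSpace ℝ (Fin d)) :
    z + axisReflection i z = (2 * z i) • EuclideanSpace.single i (1 : ℝ) := by
  rw [axisReflection, Submodule.reflection_singleton_apply]
  simp [EuclideanSpace.inner_single_left, two_mul, add_smul, two_smul]

/-- Averaging the variation of `u` over directions controls the variation along each axis. -/
lemma lintegral_mul_directionalVariation_single_le (hκ : Measurable κ)
    {u : EuclideanSpace ℝ (Fin d) → ℝ} (hu : u ∈ BVIndicator d ℓ) (i : Fin d) (δ : ℝ) :
    (∫⁻ z in Metric.ball (0 : EuclideanSpace ℝ (Fin d)) 1 \ Metric.closedBall 0 δ,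
        κ ‖z‖ * ENNReal.ofReal |‖z‖⁻¹ * z i|) *
        directionalVariation ℓ (EuclideanSpace.single i 1) u ≤
      ∫⁻ z in Metric.ball (0 : EuclideanSpace ℝ (Fin d)) 1 \ Metric.closedBall 0 δ,
        κ ‖z‖ * directionalVariation ℓ (‖z‖⁻¹ • z) u := by
  set A := Metric.ball (0 : EuclideanSpace ℝ (Fin d)) 1 \ Metric.closedBall 0 δ with hA
  set G : EuclideanSpace ℝ (Fin d) → ℝ≥0∞ := fun z =>
    κ ‖z‖ * directionalVariation ℓ (‖z‖⁻¹ • z) u with hG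
  have hGm : Measurable G := (measurable_kernel_norm hκ).mul
    (measurable_directionalVariation_unit hu)
  -- The reflection preserves both Lebesgue measure and the norm, hence the annulus.
  have hrefl : ∫⁻ z in A, G (axisReflection i z) = ∫⁻ z in A, G z := by
    have := (axisReflection i).measurePreserving.setLIntegral_comp_preimage
      (measurableSet_ball.diff measurableSet_closedBall : MeasurableSet A) hGm
    rw [← this]
    congr 2
    ext z
    simp [hA]
  have hNt : directionalVariation ℓ (EuclideanSpace.single i 1) u ≠ ⊤ :=
    ne_top_of_le_ne_top hu.2.2.2.ne (directionalVariation_le_totalVariation (by simp))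
  -- A vector and its reflection add up to `2 z_i e_i`, so subadditivity bounds the variation along
  -- the axis by the two directional variations.
  have hkey : ∀ z : EuclideanSpace ℝ (Fin d), 2 * ((κ ‖z‖ * ENNReal.ofReal |‖z‖⁻¹ * z i|) *
      directionalVariation ℓ (EuclideanSpace.single i 1) u) ≤ G z + G (axisReflection i z) := by
    intro z
    have h1 := directionalVariation_add_le (ℓ := ℓ) hu.1 (abs_le_one_of_mem_BVIndicator hu)
      (‖z‖⁻¹ • z) (‖z‖⁻¹ • axisReflection i z)
    rw [← smul_add, add_axisReflection, smul_smul, directionalVariation_smul_abs,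
      mul_left_comm, abs_mul 2, abs_two, ENNReal.ofReal_mul zero_le_two,
      ENNReal.ofReal_ofNat] at h1
    simp only [hG, LinearIsometryEquiv.norm_map, ← mul_add]
    calc _ = (κ ‖z‖ : ℝ≥0∞) * (2 * ENNReal.ofReal |‖z‖⁻¹ * z i| *
          directionalVariation ℓ (EuclideanSpace.single i 1) u) := by ring
      _ ≤ _ := mul_le_mul_right h1 _
  have h2 : 2 * ((∫⁻ z in A, κ ‖z‖ * ENNReal.ofReal |‖z‖⁻¹ * z i|) *
      directionalVariation ℓ (EuclideanSpace.single i 1) u) ≤ 2 * ∫⁻ z in A, G z := by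
    rw [← lintegral_mul_const' _ _ hNt, ← lintegral_const_mul' _ _ ENNReal.ofNat_ne_top]
    calc _ ≤ ∫⁻ z in A, (G z + G (axisReflection i z)) := lintegral_mono hkey
      _ = 2 * ∫⁻ z in A, G z := by rw [lintegral_add_left hGm, hrefl, two_mul]
  exact (ENNReal.mul_le_mul_iff_right two_ne_zero ENNReal.ofNat_ne_top).1 h2

lemma ae_apply_ne_zero (i : Fin d) : ∀ᵐ z : EuclideanSpace ℝ (Fin d), z i ≠ 0 := by
  have hker : (LinearMap.ker (EuclideanSpace.proj (𝕜 := ℝ) i :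
      EuclideanSpace ℝ (Fin d) →L[ℝ] ℝ).toLinearMap) ≠ ⊤ := by
    intro h
    have : EuclideanSpace.single i (1 : ℝ) ∈ LinearMap.ker (EuclideanSpace.proj (𝕜 := ℝ) i :
      EuclideanSpace ℝ (Fin d) →L[ℝ] ℝ).toLinearMap := h ▸ Submodule.mem_top
    simp at this
  have := Measure.addHaar_submodule volume _ hker
  rw [ae_iff]
  convert this using 2
  ext z
  simp

/-- The extra weight vanishes only on the null hyperplane `z_i = 0`. -/
lemma lintegral_annulus_axis_ne_zero (hκ : Measurable κ) (i : Fin d) {δ : ℝ}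
    (h : ∫⁻ z in Metric.ball (0 : EuclideanSpace ℝ (Fin d)) 1 \ Metric.closedBall 0 δ,
      (κ ‖z‖ : ℝ≥0∞) ≠ 0) :
    ∫⁻ z in Metric.ball (0 : EuclideanSpace ℝ (Fin d)) 1 \ Metric.closedBall 0 δ,
        (κ ‖z‖ : ℝ≥0∞) * ENNReal.ofReal |‖z‖⁻¹ * z i| ≠ 0 := by
  have hzi : Measurable fun z : EuclideanSpace ℝ (Fin d) => ENNReal.ofReal |‖z‖⁻¹ * z i| := by
    fun_prop
  contrapose! h
  have hm : Measurable fun z : EuclideanSpace ℝ (Fin d) =>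
      (κ ‖z‖ : ℝ≥0∞) * ENNReal.ofReal |‖z‖⁻¹ * z i| := (measurable_kernel_norm hκ).mul hzi
  rw [lintegral_eq_zero_iff hm] at h
  rw [lintegral_eq_zero_iff (measurable_kernel_norm hκ)]
  filter_upwards [h, ae_restrict_of_ae (ae_apply_ne_zero i)] with z hz hzi
  rcases mul_eq_zero.1 hz with h0 | h0
  · exact h0
  · have hz0 : ‖z‖ ≠ 0 := fun h0 => hzi (by simp [norm_eq_zero.1 h0])
    have : |‖z‖⁻¹ * z i| ≤ 0 := ENNReal.ofReal_eq_zero.1 h0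
    exact absurd (abs_nonpos_iff.1 this) (mul_ne_zero (inv_ne_zero hz0) hzi)

/-- Solve the definition of the density for the directional variation and bound the mean translation
by one. The last term is integrable only away from the origin, hence the use of an annulus. -/
lemma kernel_mul_directionalVariation_le (hℓ : 0 < ℓ) {u : EuclideanSpace ℝ (Fin d) → ℝ}
    (hu : u ∈ BVIndicator d ℓ) {z : EuclideanSpace ℝ (Fin d)} (hz : z ∈ Metric.ball 0 1) :
    κ ‖z‖ * directionalVariation ℓ (‖z‖⁻¹ • z) u ≤ 2 * volume (cell d ℓ) *
      (ENNReal.ofReal (limitDensity ℓ κ u z) + κ ‖z‖ * ENNReal.ofReal ‖z‖⁻¹) := by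
  have hNt := directionalVariation_unit_div_ne_top hℓ hu z
  have hV := volume_cell_ne_zero (d := d) hℓ
  have hreal : (κ ‖z‖ : ℝ) * (directionalVariation ℓ (‖z‖⁻¹ • z) u / volume (cell d ℓ)).toReal =
      2 * (limitDensity ℓ κ u z +
        κ ‖z‖ * ((2 * ‖z‖)⁻¹ * (meanTranslation ℓ u z).toReal)) := by
    rw [limitDensity, indicator_of_mem hz, mul_inv]
    ring
  have h1 : κ ‖z‖ * (directionalVariation ℓ (‖z‖⁻¹ • z) u / volume (cell d ℓ)) =
      2 * (ENNReal.ofReal (limitDensity ℓ κ u z) +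
        κ ‖z‖ * (ENNReal.ofReal (2 * ‖z‖)⁻¹ * meanTranslation ℓ u z)) := by
    rw [← ofReal_kernel_mul hu, ← ENNReal.ofReal_add (limitDensity_nonneg hℓ hu hz)
      (by positivity), show (2 : ℝ≥0∞) * _ = ENNReal.ofReal 2 * _ by rw [ENNReal.ofReal_ofNat],
      ← ENNReal.ofReal_mul zero_le_two, ← hreal, ENNReal.ofReal_mul NNReal.zero_le_coe, ENNReal.ofReal_coe_nnreal,
      ENNReal.ofReal_toReal hNt]
  calc κ ‖z‖ * directionalVariation ℓ (‖z‖⁻¹ • z) u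
      = volume (cell d ℓ) *
          (κ ‖z‖ * (directionalVariation ℓ (‖z‖⁻¹ • z) u / volume (cell d ℓ))) := by
        rw [mul_left_comm, ENNReal.mul_div_cancel hV volume_cell_ne_top]
    _ = 2 * volume (cell d ℓ) * (ENNReal.ofReal (limitDensity ℓ κ u z) +
        κ ‖z‖ * (ENNReal.ofReal (2 * ‖z‖)⁻¹ * meanTranslation ℓ u z)) := by
        rw [h1]; ring
    _ ≤ _ := mul_le_mul_right (add_le_add_right
        (mul_le_mul_right (mul_meanTranslation_le_inv hu z) _) _) _

/-- The negative part of the density has integral at most `T'`, so the positive part has integral at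
most `C + T'`. On an annulus charged by `κ` this bounds the weighted directional variations by `X`;
reflection bounds the variation along the axis `i` by `X / c i`, and summing over the axes bounds
the perimeter. The mass of `κ` near the origin may be infinite. -/
lemma limitEnergy_coercive (hd : 1 ≤ d) (hℓ : 0 < ℓ) (hκ : Measurable κ) (htail : HasTail d κ)
    (hM : 0 < kernelMass d κ) (C : ℝ) :
    ∃ B : ℝ≥0∞, B ≠ ⊤ ∧ ∀ u ∈ BVIndicator d ℓ, limitEnergy ℓ κ u ≤ C →
      totalVariation ℓ u ≤ B := by
  obtain ⟨δ, hδ, hann⟩ := exists_annulus_kernel_ne_zero hd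
    (lintegral_ball_kernel_ne_zero hd hκ hM)
  have hT := (htail δ hδ).ne
  have hT' := (htail (1 / 2) (by norm_num)).ne
  set A := Metric.ball (0 : EuclideanSpace ℝ (Fin d)) 1 \ Metric.closedBall 0 δ with hA
  set T := ∫⁻ z in (Metric.closedBall (0 : EuclideanSpace ℝ (Fin d)) δ)ᶜ,
    (κ ‖z‖ : ℝ≥0∞) * ENNReal.ofReal ‖z‖⁻¹
  set T' := ∫⁻ z in (Metric.closedBall (0 : EuclideanSpace ℝ (Fin d)) (1 / 2))ᶜ,
    (κ ‖z‖ : ℝ≥0∞) * ENNReal.ofReal ‖z‖⁻¹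
  set c : Fin d → ℝ≥0∞ := fun i => ∫⁻ z in A, κ ‖z‖ * ENNReal.ofReal |‖z‖⁻¹ * z i|
  have hc : ∀ i, c i ≠ 0 := fun i => lintegral_annulus_axis_ne_zero hκ i hann
  set X : ℝ≥0∞ := 2 * volume (cell d ℓ) * (ENNReal.ofReal (C + T'.toReal) + T)
  have hX : X ≠ ⊤ := ENNReal.mul_ne_top (ENNReal.mul_ne_top ENNReal.ofNat_ne_top
    volume_cell_ne_top) (ENNReal.add_ne_top.2 ⟨ENNReal.ofReal_ne_top, hT⟩)
  refine ⟨∑ i, X / c i, ENNReal.sum_ne_top.2 fun i _ => ENNReal.div_ne_top hX (hc i),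
    fun u hu hE => ?_⟩
  have hQ : ∫⁻ z, ENNReal.ofReal (-limitDensity ℓ κ u z) ≤ T' := by
    refine (lintegral_mono fun z => ofReal_neg_limitDensity_le hℓ hu z).trans ?_
    rw [lintegral_indicator measurableSet_closedBall.compl]
  have hP : ∫⁻ z, ENNReal.ofReal (limitDensity ℓ κ u z) ≤ ENNReal.ofReal (C + T'.toReal) := by
    rw [limitEnergy_eq hu, extIntegral] at hE
    have hQt : ∫⁻ z, ENNReal.ofReal (-limitDensity ℓ κ u z) ≠ ⊤ := ne_top_of_le_ne_top hT' hQ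
    have hQr := ENNReal.toReal_mono hT' hQ
    rw [← EReal.coe_ennreal_toReal hQt] at hE
    have hPt : ∫⁻ z, ENNReal.ofReal (limitDensity ℓ κ u z) ≠ ⊤ := by
      intro h
      rw [h, EReal.coe_ennreal_top, EReal.top_sub_coe, top_le_iff] at hE
      exact EReal.coe_ne_top _ hE
    rw [← EReal.coe_ennreal_toReal hPt, ← EReal.coe_sub, EReal.coe_le_coe_iff] at hE
    rw [← ENNReal.ofReal_toReal hPt]
    exact ENNReal.ofReal_le_ofReal (by linarith)
  have hsum : ∫⁻ z in A, κ ‖z‖ * directionalVariation ℓ (‖z‖⁻¹ • z) u ≤ X := by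
    have hAm : MeasurableSet A := measurableSet_ball.diff measurableSet_closedBall
    calc ∫⁻ z in A, κ ‖z‖ * directionalVariation ℓ (‖z‖⁻¹ • z) u
        ≤ ∫⁻ z in A, 2 * volume (cell d ℓ) * (ENNReal.ofReal (limitDensity ℓ κ u z) +
            κ ‖z‖ * ENNReal.ofReal ‖z‖⁻¹) :=
          setLIntegral_mono' hAm fun z hz => kernel_mul_directionalVariation_le hℓ hu hz.1
      _ = 2 * volume (cell d ℓ) * ((∫⁻ z in A, ENNReal.ofReal (limitDensity ℓ κ u z)) +
            ∫⁻ z in A, κ ‖z‖ * ENNReal.ofReal ‖z‖⁻¹) := by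
          rw [lintegral_const_mul' _ _
            (ENNReal.mul_ne_top ENNReal.ofNat_ne_top volume_cell_ne_top),
            lintegral_add_left (measurable_limitDensity hκ hu).ennreal_ofReal]
      _ ≤ X := by
          refine mul_le_mul_right (add_le_add ?_ ?_) _
          · exact (setLIntegral_le_lintegral _ _).trans hP
          · exact lintegral_mono_set fun z hz => hz.2
  refine (totalVariation_le_sum hu.1 (abs_le_one_of_mem_BVIndicator hu)).trans
    (Finset.sum_le_sum fun i _ => ?_)
  rw [ENNReal.le_div_iff_mul_le (Or.inl (hc i)) (Or.inr hX), mul_comm]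
  exact (lintegral_mul_directionalVariation_single_le hκ hu i δ).trans hsum

end LimitEnergy

end NonlocalPerimeter

theorem proposition1p2 (d : ℕ) (hd : 1 ≤ d) (ℓ : ℝ) (hℓ : 0 < ℓ)
    (K : ℝ → ℝ → ℝ≥0) (hK : NonlocalPerimeter.IsKernelFamily d K)
    (fraction : ℝ) (hfraction : fraction ∈ Icc (0 : ℝ) 1)
    (ε : ℝ) (hε : 0 ≤ ε) (hM : 0 < NonlocalPerimeter.kernelMass d (K ε)) :
    ∃ u ∈ NonlocalPerimeter.admissible d ℓ fraction,
      IsMinOn (NonlocalPerimeter.energy ℓ K ε)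
        (NonlocalPerimeter.admissible d ℓ fraction) u := by
  have hκ := hK.measurable ε hε
  have htail := NonlocalPerimeter.hasTail_of_lintegral hd hκ (hK.tail ε hε)
  have hne : (NonlocalPerimeter.admissible d ℓ fraction).Nonempty := by
    obtain ⟨n, rfl⟩ : ∃ n, d = n + 1 := ⟨d - 1, by omega⟩
    exact ⟨_, NonlocalPerimeter.slab_mem_admissible hℓ hfraction⟩
  rcases hε.eq_or_lt with rfl | hpos
  · have hE : NonlocalPerimeter.energy (d := d) ℓ K 0 =
        NonlocalPerimeter.limitEnergy ℓ (K 0) := by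
      ext u; simp [NonlocalPerimeter.energy]
    rw [hE]
    exact NonlocalPerimeter.exists_isMinOn_admissible hℓ hne
      (NonlocalPerimeter.limitEnergy_coercive hd hℓ hκ htail hM)
      fun un u B m hun hu hB hTV h hm =>
        NonlocalPerimeter.limitEnergy_le_of_tendsto hℓ hκ htail hun hu h hm
  · have hE : NonlocalPerimeter.energy (d := d) ℓ K ε =
        NonlocalPerimeter.approxEnergy ℓ (K ε) := by
      ext u; simp [NonlocalPerimeter.energy, hpos.ne']
    have hint := hK.integrable ε hpos
    have hMt : NonlocalPerimeter.kernelMass d (K ε) ≠ ⊤ :=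
      ENNReal.mul_ne_top measure_ball_lt_top.ne hint.ne
    have hI : ∫⁻ z in Metric.ball (0 : EuclideanSpace ℝ (Fin d)) 1, (K ε ‖z‖ : ℝ≥0∞) ≠ ⊤ := by
      rw [NonlocalPerimeter.lintegral_ball_kernel hd hκ]
      exact ENNReal.mul_ne_top (ENNReal.mul_ne_top (ENNReal.natCast_ne_top d)
        measure_ball_lt_top.ne) hint.ne
    rw [hE]
    exact NonlocalPerimeter.exists_isMinOn_admissible hℓ hne
      (NonlocalPerimeter.approxEnergy_coercive hd hℓ htail hI hM.ne' hMt)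
      fun un u B m hun _ hB hTV h hm =>
        NonlocalPerimeter.approxEnergy_le_of_tendsto hℓ hκ htail hI hMt hun hB hTV h hm
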